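/- A (plain) multicategory has objects and morphisms $T:X_1\times\dots\times X_d\to Y$ ($d\ge 0$) with an associative and unital plugging operation $T\circ(T_1\times\dots\times T_d)$; a natural transformation $\varphi:F\to G$ of functors is a family of unary morphisms $\varphi_X:F(X)\to G(X)$ with $\varphi_Y\circ F(T)=G(T)\circ(\varphi_{X_1}\times\dots\times\varphi_{X_d})$ for all $T$. Two multicategories $M,N$ are equivalent if there are functors $F:M\to N$ and $G:N\to M$ such that $F\circ G$ and $G\circ F$ are naturally equivalent to the identity functors. For a field $k$, $\mathrm{Rep}_k(M)$ is the category of functors from $M$ to the multicategory of $k$-vector spaces and multilinear maps, whose morphisms are the intertwiners, i.e. the families of linear maps $V_X\to V'_X$ that commute with the action of every morphism of $M$. An $n$-disk is a disk with $n$ pins on its boundary, numbered anticlockwise; an $(m,n)$-box is a rectangle with $m$ pins on its lower and $n$ pins on its upper edge. A planar diagram in an outer disk (box) consists of finitely many disjoint numbered inner disks (boxes), placed in its interior in an orientation-preserving way, and of finitely many disjoint strings (arcs and closed loops) in the region outside of the inner ones, such that every pin, inner or outer, is the endpoint of exactly one string and every endpoint of a string is a pin. Diagrams are taken up to planar isotopy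 fixing the outer boundary. Let $\mathcal D_\circ$ (resp. $\mathcal D_\square$) be the multicategory whose objects are the $n$-disks, $n\ge 0$ (resp. the $(m,n)$-boxes, $m,n\ge0$), whose morphisms $X_1\times\dots\times X_d\to Y$ are the isotopy classes of planar diagrams with outer disk (box) $Y$ and inner disks (boxes) $X_1,\dots,X_d$, with composition given by inserting diagrams into the inner disks (boxes). Let $\mathcal D_\circ^{\mathrm{even}}$ and $\mathcal D_\square^{\mathrm{even}}$ be the full submulticategories on the objects with an even total number of pins, and let $\mathcal D_\triangle$ be the full submulticategory of $\mathcal D_\square^{\mathrm{even}}$ on the $(n,n)$-boxes. Proposition. The multicategories $\mathcal D_\circ$ and $\mathcal D_\square$ are equivalent. The three multicategories $\mathcal D_\circ^{\mathrm{even}}$, $\mathcal D_\square^{\mathrm{even}}$ and $\mathcal D_\triangle$ are mutually equivalent. Consequently, for every field $k$, the categories $\mathrm{Rep}_k(\mathcal D_\circ)$ and $\mathrm{Rep}_k(\mathcal D_\square)$ are equivalent, and the three categories $\mathrm{Rep}_k(\mathcal D_\circ^{\mathrm{even}})$, $\mathrm{Rep}_k(\mathcal D_\square^{\mathrm{even}})$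 and $\mathrm{Rep}_k(\mathcal D_\triangle)$ are mutually equivalent. -/

import Mathlib

open CategoryTheory

namespace PlanarDiagrams

universe u v u' v' w

/-! ### Multicategories -/

/-- Concatenation of the sequences `Z 0, Z 1, …, Z (d - 1)`; position `k` of the concatenation is
position `j` of `Z i` for `⟨i, j⟩ = finSigmaFinEquiv.symm k` (lexicographic order). -/
abbrev concat {A : Type*} {d : ℕ} {e : Fin d → ℕ} (Z : (i : Fin d) → Fin (e i) → A) :
    Fin (∑ i, e i) → A :=
  fun k => Z (finSigmaFinEquiv.symm k).1 (finSigmaFinEquiv.symm k).2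

set_option linter.checkUnivs false in
/-- A (plain) multicategory: morphisms have a finite sequence of inputs and one output, and
`comp T U` plugs `U i` into the `i`-th input of `T`. The two sides of each axiom have inputs which
are equal sequences, but not by definition, whence the heterogeneous equalities. -/
structure Multicategory where
  Obj : Type u
  Hom : {d : ℕ} → (Fin d → Obj) → Obj → Type v
  id : (X : Obj) → Hom (fun _ : Fin 1 => X) X
  comp : {d : ℕ} → {X : Fin d → Obj} → {Y : Obj} → {e : Fin d → ℕ} →
    {Z : (i : Fin d) → Fin (e i) → Obj} →
    Hom X Y → ((i : Fin d) → Hom (Z i) (X i)) → Hom (concat Z) Y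
  id_comp : ∀ {d : ℕ} {X : Fin d → Obj} {Y : Obj} (T : Hom X Y),
    HEq (comp (id Y) (fun _ => T)) T
  comp_id : ∀ {d : ℕ} {X : Fin d → Obj} {Y : Obj} (T : Hom X Y),
    HEq (comp T (fun i => id (X i))) T
  assoc : ∀ {d : ℕ} {X : Fin d → Obj} {Y : Obj} {e : Fin d → ℕ}
    {Z : (i : Fin d) → Fin (e i) → Obj} {f : (i : Fin d) → Fin (e i) → ℕ}
    {V : (i : Fin d) → (j : Fin (e i)) → Fin (f i j) → Obj}
    (T : Hom X Y) (U : (i : Fin d) → Hom (Z i) (X i))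
    (W : (i : Fin d) → (j : Fin (e i)) → Hom (V i j) (Z i j)),
    HEq (comp (comp T U) (fun k => W (finSigmaFinEquiv.symm k).1 (finSigmaFinEquiv.symm k).2))
      (comp T (fun i => comp (U i) (W i)))

/-- The full submulticategory on the objects that satisfy `P`. -/
def Multicategory.full (M : Multicategory.{u, v}) (P : M.Obj → Prop) : Multicategory.{u, v} where
  Obj := {X : M.Obj // P X}
  Hom X Y := M.Hom (fun i => (X i).1) Y.1
  id X := M.id X.1
  comp T U := M.comp T U
  id_comp T := M.id_comp T
  comp_id T := M.comp_id T
  assoc T U W := M.assoc T U W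

/-- Functors between multicategories. -/
structure MFunctor (M : Multicategory.{u, v}) (N : Multicategory.{u', v'}) where
  obj : M.Obj → N.Obj
  map : {d : ℕ} → {X : Fin d → M.Obj} → {Y : M.Obj} →
    M.Hom X Y → N.Hom (fun i => obj (X i)) (obj Y)
  map_id : ∀ X : M.Obj, map (M.id X) = N.id (obj X)
  map_comp : ∀ {d : ℕ} {X : Fin d → M.Obj} {Y : M.Obj} {e : Fin d → ℕ}
    {Z : (i : Fin d) → Fin (e i) → M.Obj} (T : M.Hom X Y) (U : (i : Fin d) → M.Hom (Z i) (X i)),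
    map (M.comp T U) = N.comp (map T) (fun i => map (U i))

/-- The identity functor. -/
def MFunctor.id (M : Multicategory.{u, v}) : MFunctor M M where
  obj X := X
  map T := T
  map_id _ := rfl
  map_comp _ _ := rfl

/-- `F.comp G` is `F` followed by `G`. -/
def MFunctor.comp {L : Multicategory.{u, v}} {M : Multicategory.{u', v'}} {N : Multicategory}
    (F : MFunctor L M) (G : MFunctor M N) : MFunctor L N where
  obj X := G.obj (F.obj X)
  map T := G.map (F.map T)
  map_id X := by rw [F.map_id, G.map_id]
  map_comp T U := by rw [F.map_comp, G.map_comp]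

/-- Natural transformations: `φ_Y ∘ F(T) = G(T) ∘ (φ_{X_1} × … × φ_{X_d})` for all `T`. -/
structure MNatTrans {M : Multicategory.{u, v}} {N : Multicategory.{u', v'}}
    (F G : MFunctor M N) where
  app : (X : M.Obj) → N.Hom (fun _ : Fin 1 => F.obj X) (G.obj X)
  naturality : ∀ {d : ℕ} {X : Fin d → M.Obj} {Y : M.Obj} (T : M.Hom X Y),
    HEq (N.comp (app Y) (fun _ => F.map T)) (N.comp (G.map T) (fun i => app (X i)))

/-- Natural equivalences: natural transformations with an inverse. -/
structure MNatIso {M : Multicategory.{u, v}} {N : Multicategory.{u', v'}}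
    (F G : MFunctor M N) where
  hom : MNatTrans F G
  inv : MNatTrans G F
  hom_inv : ∀ X : M.Obj, HEq (N.comp (inv.app X) (fun _ => hom.app X)) (N.id (F.obj X))
  inv_hom : ∀ X : M.Obj, HEq (N.comp (hom.app X) (fun _ => inv.app X)) (N.id (G.obj X))

/-- Equivalence of multicategories. -/
def Multicategory.Equivalent (M : Multicategory.{u, v}) (N : Multicategory.{u', v'}) : Prop :=
  ∃ (F : MFunctor M N) (G : MFunctor N M),
    Nonempty (MNatIso (G.comp F) (MFunctor.id N)) ∧ Nonempty (MNatIso (F.comp G) (MFunctor.id M))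

/-! ### Bookkeeping for iterated concatenation -/

theorem finSigma_lt_iff {d : ℕ} {e : Fin d → ℕ} (i i' : Fin d) (j : Fin (e i)) (j' : Fin (e i')) :
    (finSigmaFinEquiv ⟨i, j⟩ : Fin (∑ i, e i)) < finSigmaFinEquiv ⟨i', j'⟩ ↔
      i < i' ∨ (i = i' ∧ (j : ℕ) < j') := by
  have key : ∀ (i i' : Fin d) (j : Fin (e i)) (j' : Fin (e i')), i < i' →
      (finSigmaFinEquiv ⟨i, j⟩ : Fin (∑ i, e i)) < finSigmaFinEquiv ⟨i', j'⟩ := by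
    intro i i' j j' h
    rw [Fin.lt_def, finSigmaFinEquiv_apply, finSigmaFinEquiv_apply]
    have h1 : ∀ i : Fin d, ∑ a : Fin i, e (Fin.castLE i.2.le a) =
        ∑ a ∈ Finset.univ.filter (fun a : Fin d => a < i), e a := by
      intro i
      refine Finset.sum_bij (fun a _ => Fin.castLE i.2.le a) ?_ ?_ ?_ ?_
      · intro a _
        simp only [Finset.mem_filter, Finset.mem_univ, true_and]
        exact a.2
      · intro a _ b _ hab
        simpa [Fin.ext_iff] using hab
      · intro b hb
        simp only [Finset.mem_filter, Finset.mem_univ, true_and, Fin.lt_def] at hb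
        exact ⟨⟨b, hb⟩, Finset.mem_univ _, rfl⟩
      · intro a _
        rfl
    simp only [h1]
    have h2 : insert i (Finset.univ.filter (fun a : Fin d => a < i)) ⊆
        Finset.univ.filter (fun a : Fin d => a < i') := by
      intro a ha
      simp only [Finset.mem_insert, Finset.mem_filter, Finset.mem_univ, true_and] at ha ⊢
      rcases ha with rfl | ha
      · exact h
      · exact ha.trans h
    have h3 := Finset.sum_le_sum_of_subset (f := e) h2
    rw [Finset.sum_insert (by simp)] at h3
    have := j.2
    omega
  rcases lt_trichotomy i i' with h | h | h
  · simp [h, key i i' j j' h]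
  · subst h
    rw [Fin.lt_def, finSigmaFinEquiv_apply, finSigmaFinEquiv_apply]
    simp
  · have := key i' i j' j h
    constructor
    · intro h'
      exact absurd (this.trans h') (lt_irrefl _)
    · rintro (h' | ⟨h', _⟩)
      · exact absurd (h.trans h') (lt_irrefl _)
      · exact absurd (h' ▸ h) (lt_irrefl _)

theorem val_eq_of_lt_iff {A : Type*} {m n : ℕ} (f : A ≃ Fin m) (g : A ≃ Fin n)
    (h : ∀ a b, f a < f b ↔ g a < g b) (a : A) : (f a : ℕ) = g a := by
  classical
  let _ : Fintype A := Fintype.ofEquiv _ f.symm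
  have key : ∀ {m : ℕ} (f : A ≃ Fin m), (f a : ℕ) =
      (Finset.univ.filter (fun b => f b < f a)).card := by
    intro m f
    rw [← Finset.card_map f.toEmbedding]
    have : (Finset.univ.filter (fun b => f b < f a)).map f.toEmbedding = Finset.Iio (f a) := by
      ext k
      simp only [Finset.mem_map, Finset.mem_filter, Finset.mem_univ, true_and, Finset.mem_Iio]
      constructor
      · rintro ⟨b, hb, rfl⟩
        exact hb
      · intro hk
        exact ⟨f.symm k, by simpa using hk, by simp⟩
    rw [this, Fin.card_Iio]
  rw [key f, key g]
  simp only [h]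

/-- Concatenating in two steps or at once gives the same positions. -/
theorem finSigma_assoc {d : ℕ} {e : Fin d → ℕ} {f : (i : Fin d) → Fin (e i) → ℕ}
    (k : Fin (∑ i, e i))
    (l : Fin (f (finSigmaFinEquiv.symm k).1 (finSigmaFinEquiv.symm k).2)) :
    ((finSigmaFinEquiv ⟨k, l⟩ : Fin (∑ k, concat f k)) : ℕ) =
      (finSigmaFinEquiv ⟨(finSigmaFinEquiv.symm k).1,
        finSigmaFinEquiv ⟨(finSigmaFinEquiv.symm k).2, l⟩⟩ : Fin (∑ i, ∑ j, f i j)) := by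
  let A := (k : Fin (∑ i, e i)) × Fin (concat f k)
  let g : A ≃ Fin (∑ i, ∑ j, f i j) :=
    ((finSigmaFinEquiv (n := e)).symm.sigmaCongrLeft
      (β := fun p : (i : Fin d) × Fin (e i) => Fin (f p.1 p.2))).trans
      ((Equiv.sigmaAssoc (fun i j => Fin (f i j))).trans
        ((Equiv.sigmaCongrRight (fun i => finSigmaFinEquiv (n := f i))).trans finSigmaFinEquiv))
  have hg : ∀ a : A, g a = finSigmaFinEquiv ⟨(finSigmaFinEquiv.symm a.1).1,
      finSigmaFinEquiv ⟨(finSigmaFinEquiv.symm a.1).2, a.2⟩⟩ := fun a => rfl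
  have aux : ∀ (p p' : (i : Fin d) × Fin (e i)) (l : Fin (f p.1 p.2)) (l' : Fin (f p'.1 p'.2)),
      (p.1 < p'.1 ∨ p.1 = p'.1 ∧ (p.2 : ℕ) < p'.2) ∨ p = p' ∧ (l : ℕ) < l' ↔
      p.1 < p'.1 ∨ p.1 = p'.1 ∧ ((finSigmaFinEquiv ⟨p.2, l⟩ : Fin (∑ j, f p.1 j)) : ℕ) <
        (finSigmaFinEquiv ⟨p'.2, l'⟩ : Fin (∑ j, f p'.1 j)) := by
    rintro ⟨i, j⟩ ⟨i', j'⟩ l l'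
    dsimp only at l l' ⊢
    by_cases hi : i = i'
    · subst hi
      by_cases hj : j = j'
      · subst hj
        simp [finSigma_lt_iff, -finSigmaFinEquiv_apply]
      · simp [hj, finSigma_lt_iff, -finSigmaFinEquiv_apply]
    · simp [hi]
  have := val_eq_of_lt_iff (A := A) finSigmaFinEquiv g ?_ ⟨k, l⟩
  · rw [this, hg]
  · rintro ⟨k, l⟩ ⟨k', l'⟩
    rw [hg, hg, finSigma_lt_iff, finSigma_lt_iff]
    have h1 := finSigma_lt_iff (e := e) (finSigmaFinEquiv.symm k).1 (finSigmaFinEquiv.symm k').1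
      (finSigmaFinEquiv.symm k).2 (finSigmaFinEquiv.symm k').2
    simp only [Sigma.eta, Equiv.apply_symm_apply] at h1
    have h2 : k = k' ↔ finSigmaFinEquiv.symm k = finSigmaFinEquiv.symm k' := by simp
    rw [h1, h2]
    exact aux _ _ l l'

theorem finSigma_assoc_card {d : ℕ} {e : Fin d → ℕ} (f : (i : Fin d) → Fin (e i) → ℕ) :
    ∑ k, concat f k = ∑ i, ∑ j, f i j := by
  rw [← finSigmaFinEquiv.sum_comp, Fintype.sum_sigma]
  refine Finset.sum_congr rfl fun i _ => Finset.sum_congr rfl fun j _ => ?_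
  simp only [concat]
  rw [Equiv.symm_apply_apply]

theorem finSigma_one (d : ℕ) (i : Fin d) :
    ((finSigmaFinEquiv ⟨i, 0⟩ : Fin (∑ _ : Fin d, 1)) : ℕ) = i := by
  simp [finSigmaFinEquiv_apply]

/-! ### The multicategory of vector spaces, and representations -/

section MRep

variable (k : Type u) [Field k]

theorem multilinear_heq {d d' : ℕ} {X : Fin d → ModuleCat.{w} k} {X' : Fin d' → ModuleCat.{w} k}
    {Y : ModuleCat.{w} k} (hd : d = d') (hX : ∀ i, X i = X' (Fin.cast hd i))
    (T : MultilinearMap k (fun i => X i) Y) (T' : MultilinearMap k (fun i => X' i) Y)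
    (h : ∀ (x : ∀ i, X i) (x' : ∀ i, X' i), (∀ i, HEq (x i) (x' (Fin.cast hd i))) → T x = T' x') :
    HEq T T' := by
  subst hd
  obtain rfl : X = X' := funext hX
  exact heq_of_eq (MultilinearMap.ext fun x => h x x fun _ => HEq.rfl)

theorem piCongrLeft'_symm_heq {α β : Type*} {P : α → Type*} (σ : α ≃ β)
    (x : (b : β) → P (σ.symm b)) (a : α) : HEq ((σ.piCongrLeft' P).symm x a) (x (σ a)) := by
  obtain ⟨b, rfl⟩ := σ.symm.surjective a
  rw [Equiv.piCongrLeft'_symm_apply_apply, Equiv.apply_symm_apply]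

theorem sigma_heq {A : Type*} {B : A → Type*} {P : (a : A) → B a → Type*} (g : ∀ a b, P a b)
    {a : A} {b : B a} {p : (a : A) × B a} (h : p = ⟨a, b⟩) : HEq (g a b) (g p.1 p.2) := by
  subst h
  rfl

variable {k} in
/-- Composition of multilinear maps. -/
def multilinearComp {d : ℕ} {X : Fin d → ModuleCat.{w} k} {Y : ModuleCat.{w} k} {e : Fin d → ℕ}
    {Z : (i : Fin d) → Fin (e i) → ModuleCat.{w} k} (T : MultilinearMap k (fun i => X i) Y)
    (U : (i : Fin d) → MultilinearMap k (fun j => Z i j) (X i)) :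
    MultilinearMap k (fun l => (concat Z l : ModuleCat.{w} k)) Y :=
  MultilinearMap.domDomCongrLinearEquiv' k k (fun p : (i : Fin d) × Fin (e i) => Z p.1 p.2) Y
    finSigmaFinEquiv (T.compMultilinearMap U)

variable {k} in
theorem multilinearComp_apply {d : ℕ} {X : Fin d → ModuleCat.{w} k} {Y : ModuleCat.{w} k}
    {e : Fin d → ℕ} {Z : (i : Fin d) → Fin (e i) → ModuleCat.{w} k}
    (T : MultilinearMap k (fun i => X i) Y)
    (U : (i : Fin d) → MultilinearMap k (fun j => Z i j) (X i)) (x : ∀ l, (concat Z l : ModuleCat.{w} k))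
    (y : ∀ i j, Z i j) (h : ∀ i j, HEq (y i j) (x (finSigmaFinEquiv ⟨i, j⟩))) :
    multilinearComp T U x = T (fun i => U i (y i)) := by
  change T (fun i => U i (fun j => (finSigmaFinEquiv.piCongrLeft'
    (fun p : (i : Fin d) × Fin (e i) => Z p.1 p.2)).symm x ⟨i, j⟩)) = _
  congr 1
  funext i
  congr 1
  funext j
  exact eq_of_heq ((piCongrLeft'_symm_heq
    (P := fun p : (i : Fin d) × Fin (e i) => (Z p.1 p.2 : Type w)) finSigmaFinEquiv x ⟨i, j⟩).trans (h i j).symm)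

/-- The multicategory of vector spaces over `k` and multilinear maps. -/
def MVec : Multicategory where
  Obj := ModuleCat.{w} k
  Hom X Y := MultilinearMap k (fun i => X i) Y
  id X := MultilinearMap.ofSubsingleton k X X (0 : Fin 1) LinearMap.id
  comp T U := multilinearComp T U
  id_comp {d X Y} T := by
    have hv : ∀ j : Fin d, (finSigmaFinEquiv ⟨0, j⟩ : Fin (∑ _ : Fin 1, d)) =
        Fin.cast (by simp) j := fun j => Fin.ext (by rw [finSigmaFinEquiv_one]; rfl)
    have hs : ∀ l : Fin (∑ _ : Fin 1, d),
        (finSigmaFinEquiv.symm l).2 = Fin.cast (by simp) l := by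
      intro l
      obtain ⟨⟨i, j⟩, rfl⟩ := finSigmaFinEquiv.surjective l
      rw [Equiv.symm_apply_apply]
      exact Fin.ext (finSigmaFinEquiv_one _).symm
    refine multilinear_heq k (by simp) (fun l => congrArg X (hs l)) _ _ ?_
    intro x x' h
    rw [multilinearComp_apply _ _ x (fun _ j => x' j) ?_]
    · rfl
    · intro i j
      obtain rfl : i = 0 := Subsingleton.elim _ _
      refine HEq.trans ?_ (h _).symm
      rw [hv]
      rfl
  comp_id {d X Y} T := by
    have hs : ∀ l : Fin (∑ _ : Fin d, 1),
        (finSigmaFinEquiv.symm l).1 = Fin.cast (by simp) l := by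
      intro l
      obtain ⟨⟨i, j⟩, rfl⟩ := finSigmaFinEquiv.surjective l
      rw [Equiv.symm_apply_apply]
      obtain rfl : j = 0 := Subsingleton.elim _ _
      exact Fin.ext (finSigma_one d i).symm
    refine multilinear_heq k (by simp) (fun l => congrArg X (hs l)) _ _ ?_
    intro x x' h
    rw [multilinearComp_apply _ _ x (fun i _ => x' i) ?_]
    · rfl
    · intro i j
      obtain rfl : j = 0 := Subsingleton.elim _ _
      have : Fin.cast (by simp) (finSigmaFinEquiv ⟨i, 0⟩ : Fin (∑ _ : Fin d, 1)) = i :=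
        Fin.ext (finSigma_one d i)
      refine HEq.trans ?_ (h _).symm
      rw [this]
  assoc {d X Y e Z f V} T U W := by
    have hs : ∀ n : Fin (∑ k, concat f k), ∀ n' : Fin (∑ i, ∑ j, f i j), (n : ℕ) = n' →
        concat (fun k => V (finSigmaFinEquiv.symm k).1 (finSigmaFinEquiv.symm k).2) n =
        concat (fun i => concat (V i)) n' := by
      intro n n' h
      obtain ⟨⟨k, l⟩, rfl⟩ := finSigmaFinEquiv.surjective n
      obtain rfl := Fin.ext (h.symm.trans (finSigma_assoc k l))
      simp only [concat]
      rw [Equiv.symm_apply_apply, Equiv.symm_apply_apply, Equiv.symm_apply_apply]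
    refine multilinear_heq k (finSigma_assoc_card f) (fun l => hs _ _ rfl) _ _ ?_
    intro x x' h
    have hx : ∀ i j l, ∃ y : V i j l, HEq y (x' (finSigmaFinEquiv ⟨i, finSigmaFinEquiv ⟨j, l⟩⟩)) := by
      intro i j l
      refine ⟨cast ?_ (x' (finSigmaFinEquiv ⟨i, finSigmaFinEquiv ⟨j, l⟩⟩)), cast_heq _ _⟩
      simp only [concat]
      rw [Equiv.symm_apply_apply, Equiv.symm_apply_apply]
    choose y hy using hx
    have hy2 : ∀ i, ∃ y2 : ∀ m, (concat (V i) m : ModuleCat.{w} k), ∀ j l, HEq (y i j l) (y2 (finSigmaFinEquiv ⟨j, l⟩)) := by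
      intro i
      refine ⟨fun m => y i (finSigmaFinEquiv.symm m).1 (finSigmaFinEquiv.symm m).2, ?_⟩
      intro j l
      exact sigma_heq (y i) (Equiv.symm_apply_apply _ _)
    choose y2 hy2 using hy2
    rw [multilinearComp_apply (Z := fun k => V (finSigmaFinEquiv.symm k).1 (finSigmaFinEquiv.symm k).2)
      _ _ x (fun k l => y _ _ l) ?_]
    · rw [multilinearComp_apply _ _ _ (fun i j => W i j (y i j)) ?_]
      · rw [multilinearComp_apply _ _ x' y2 ?_]
        · congr 1
          funext i
          rw [multilinearComp_apply _ _ _ (y i) (hy2 i)]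
        · intro i m
          obtain ⟨⟨j, l⟩, rfl⟩ := finSigmaFinEquiv.surjective m
          exact (hy2 i j l).symm.trans (hy i j l)
      · intro i j
        exact sigma_heq (fun i j => W i j (y i j)) (Equiv.symm_apply_apply _ _)
    · intro n l
      refine (hy _ _ _).trans (HEq.trans ?_ (h _).symm)
      have : (finSigmaFinEquiv ⟨(finSigmaFinEquiv.symm n).1,
        finSigmaFinEquiv ⟨(finSigmaFinEquiv.symm n).2, l⟩⟩ : Fin (∑ i, ∑ j, f i j)) =
        Fin.cast (finSigma_assoc_card f) (finSigmaFinEquiv ⟨n, l⟩) :=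
        Fin.ext (finSigma_assoc n l).symm
      rw [this]

/-- Linear representations of a multicategory over `k`. -/
def MRep (M : Multicategory.{u', v'}) := MFunctor M (MVec.{u, w} k)

variable {k}

/-- The vector space `V_X` of a representation. -/
def MRep.space {M : Multicategory.{u', v'}} (V : MRep.{u, u', v', w} k M) (X : M.Obj) :
    ModuleCat.{w} k := V.obj X

/-- The multilinear map `π_T : V_{X_1} × … × V_{X_d} → V_Y` of a representation. -/
def MRep.act {M : Multicategory.{u', v'}} (V : MRep.{u, u', v', w} k M) {d : ℕ} {X : Fin d → M.Obj}
    {Y : M.Obj} (T : M.Hom X Y) : MultilinearMap k (fun i => V.space (X i)) (V.space Y) := V.map T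

/-- Intertwiners: families of linear maps that commute with the action of all morphisms. -/
@[ext]
structure Intertwiner {M : Multicategory.{u', v'}} (V V' : MRep.{u, u', v', w} k M) where
  app : (X : M.Obj) → V.space X →ₗ[k] V'.space X
  comm : ∀ {d : ℕ} {X : Fin d → M.Obj} {Y : M.Obj} (T : M.Hom X Y) (x : ∀ i, V.space (X i)),
    app Y (V.act T x) = V'.act T (fun i => app (X i) (x i))

/-- The category of representations and intertwiners. -/
instance (M : Multicategory.{u', v'}) : Category (MRep.{u, u', v', w} k M) where
  Hom V V' := Intertwiner V V'
  id V := { app := fun X => LinearMap.id, comm := fun _ _ => rfl }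
  comp φ ψ :=
    { app := fun X => (ψ.app X).comp (φ.app X)
      comm := fun T x => by simp [φ.comm, ψ.comm] }

end MRep

end PlanarDiagrams

namespace PlanarDiagrams

open Set Filter
open scoped Topology unitInterval

/-! ### Isotopies of the plane -/

/-- An isotopy of the plane `ℂ` that starts at the identity: a level-preserving homeomorphism of
`[0, 1] × ℂ` that is the identity at time `0`. -/
structure PlaneIsotopy where
  toHomeo : (I × ℂ) ≃ₜ (I × ℂ)
  fst_eq : ∀ x, (toHomeo x).1 = x.1
  start : ∀ z, toHomeo (0, z) = (0, z)

namespace PlaneIsotopy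

/-- The position at time `t` of the point that starts at `z`. -/
noncomputable def eval (H : PlaneIsotopy) (t : I) (z : ℂ) : ℂ := (H.toHomeo (t, z)).2

theorem toHomeo_eq (H : PlaneIsotopy) (t : I) (z : ℂ) : H.toHomeo (t, z) = (t, H.eval t z) :=
  Prod.ext (H.fst_eq _) rfl

theorem symm_fst (H : PlaneIsotopy) (x : I × ℂ) : (H.toHomeo.symm x).1 = x.1 := by
  have := H.fst_eq (H.toHomeo.symm x)
  rw [Homeomorph.apply_symm_apply] at this
  exact this.symm

/-- The constant isotopy. -/
noncomputable def refl : PlaneIsotopy where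
  toHomeo := Homeomorph.refl _
  fst_eq _ := rfl
  start _ := rfl

/-- The inverse isotopy. -/
noncomputable def symm (H : PlaneIsotopy) : PlaneIsotopy where
  toHomeo := H.toHomeo.symm
  fst_eq := H.symm_fst
  start z := by rw [Homeomorph.symm_apply_eq, H.start]

/-- First `H`, then `G`, at each time. -/
noncomputable def trans (H G : PlaneIsotopy) : PlaneIsotopy where
  toHomeo := H.toHomeo.trans G.toHomeo
  fst_eq x := by simp [G.fst_eq, H.fst_eq]
  start z := by simp [H.start, G.start]

/-- The isotopy `H` seen through a homeomorphism `φ` of the plane. -/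
noncomputable def conj (H : PlaneIsotopy) (φ : ℂ ≃ₜ ℂ) : PlaneIsotopy where
  toHomeo := (((Homeomorph.refl I).prodCongr φ.symm).trans H.toHomeo).trans
    ((Homeomorph.refl I).prodCongr φ)
  fst_eq x := by simp [H.fst_eq]
  start z := by simp [H.start]

theorem eval_refl (t : I) (z : ℂ) : refl.eval t z = z := rfl

theorem eval_trans (H G : PlaneIsotopy) (t : I) (z : ℂ) :
    (H.trans G).eval t z = G.eval t (H.eval t z) := by
  change (G.toHomeo (H.toHomeo (t, z))).2 = _
  rw [H.toHomeo_eq]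
  rfl

theorem eval_symm_eval (H : PlaneIsotopy) (t : I) (z : ℂ) : H.symm.eval t (H.eval t z) = z := by
  change (H.toHomeo.symm (t, H.eval t z)).2 = z
  rw [← H.toHomeo_eq, Homeomorph.symm_apply_apply]

theorem eval_eval_symm (H : PlaneIsotopy) (t : I) (z : ℂ) : H.eval t (H.symm.eval t z) = z :=
  H.symm.eval_symm_eval t z

theorem eval_injective (H : PlaneIsotopy) (t : I) : Function.Injective (H.eval t) :=
  Function.LeftInverse.injective (H.eval_symm_eval t)

theorem eval_surjective (H : PlaneIsotopy) (t : I) : Function.Surjective (H.eval t) :=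
  Function.RightInverse.surjective (H.eval_eval_symm t)

theorem eval_conj (H : PlaneIsotopy) (φ : ℂ ≃ₜ ℂ) (t : I) (z : ℂ) :
    (H.conj φ).eval t (φ z) = φ (H.eval t z) := by
  change φ (H.toHomeo (t, φ.symm (φ z))).2 = _
  rw [φ.symm_apply_apply]
  rfl

theorem eval_mem (H : PlaneIsotopy) {t : I} {B : Set ℂ} (h : ∀ z, z ∉ B → H.eval t z = z) {z : ℂ}
    (hz : z ∈ B) : H.eval t z ∈ B := by
  by_contra h'
  have := H.eval_injective t (h _ h')
  exact h' (this.symm ▸ hz)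

theorem image_eq_of_iff (H : PlaneIsotopy) {t : I} {S S' : Set ℂ}
    (h : ∀ z, z ∈ S ↔ H.eval t z ∈ S') : H.eval t '' S = S' := by
  ext w
  obtain ⟨z, rfl⟩ := H.eval_surjective t w
  rw [(H.eval_injective t).mem_set_image, h]

/-- Isotopies supported in disjoint sets can be performed simultaneously. -/
theorem exists_glue {ι : Type*} [Finite ι] (φ : ι → ℂ ≃ₜ ℂ) (B : ι → Set ℂ)
    (hB : ∀ i j, i ≠ j → Disjoint (φ i '' B i) (φ j '' B j)) (G : ι → PlaneIsotopy)
    (hG : ∀ i t z, z ∉ B i → (G i).eval t z = z) :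
    ∃ K : PlaneIsotopy, (∀ i t z, z ∈ B i → K.eval t (φ i z) = φ i ((G i).eval t z)) ∧
      ∀ t z, (∀ i, z ∉ φ i '' B i) → K.eval t z = z := by
  classical
  have := Fintype.ofFinite ι
  suffices h : ∀ s : Finset ι, ∃ K : PlaneIsotopy,
      (∀ i ∈ s, ∀ t z, z ∈ B i → K.eval t (φ i z) = φ i ((G i).eval t z)) ∧
      ∀ t z, (∀ i ∈ s, z ∉ φ i '' B i) → K.eval t z = z by
    obtain ⟨K, h1, h2⟩ := h Finset.univ
    exact ⟨K, fun i => h1 i (Finset.mem_univ i), fun t z hz => h2 t z fun i _ => hz i⟩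
  intro s
  induction s using Finset.induction_on with
  | empty => exact ⟨refl, by simp, fun _ _ _ => rfl⟩
  | insert j s hj ih =>
    obtain ⟨K, h1, h2⟩ := ih
    have hout : ∀ t z, z ∉ φ j '' B j → ((G j).conj (φ j)).eval t z = z := by
      intro t z hz
      obtain ⟨x, rfl⟩ := (φ j).surjective z
      rw [eval_conj, hG]
      exact fun hx => hz ⟨x, hx, rfl⟩
    refine ⟨K.trans ((G j).conj (φ j)), ?_, ?_⟩
    · intro i hi t z hz
      rw [eval_trans]
      rcases Finset.mem_insert.1 hi with rfl | hi
      · rw [h2, eval_conj]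
        intro k hk hzk
        exact disjoint_left.1 (hB i k (fun h => hj (h ▸ hk))) ⟨z, hz, rfl⟩ hzk
      · rw [h1 i hi t z hz, hout]
        intro hzj
        exact disjoint_left.1 (hB i j (fun h => hj (h ▸ hi)))
          ⟨_, (G i).eval_mem (hG i t) hz, rfl⟩ hzj
    · intro t z hz
      rw [eval_trans, h2 t z fun i hi => hz i (Finset.mem_insert_of_mem hi),
        hout t z (hz j (Finset.mem_insert_self _ _))]

end PlaneIsotopy

/-- Homeomorphisms of the plane that are isotopic to the identity, that is, the
orientation-preserving ones. -/
def IsotopicToId (φ : ℂ ≃ₜ ℂ) : Prop := ∃ H : PlaneIsotopy, ∀ z, H.eval 1 z = φ z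

theorem IsotopicToId.trans {φ ψ : ℂ ≃ₜ ℂ} (hφ : IsotopicToId φ) (hψ : IsotopicToId ψ) :
    IsotopicToId (φ.trans ψ) := by
  obtain ⟨H, hH⟩ := hφ
  obtain ⟨G, hG⟩ := hψ
  exact ⟨H.trans G, fun z => by rw [PlaneIsotopy.eval_trans, hH, hG]; rfl⟩

/-! ### Bodies with pins -/

/-- A closed topological disk `{z | gauge z ≤ 1}` around the origin of the plane, star-shaped
about the origin, with finitely many pins on its boundary `{z | gauge z = 1}`. -/
structure PinnedBody where
  gauge : ℂ → ℝ
  continuous_gauge : Continuous gauge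
  gauge_smul : ∀ (t : ℝ) (z : ℂ), 0 ≤ t → gauge (t • z) = t * gauge z
  gauge_pos : ∀ z, z ≠ 0 → 0 < gauge z
  Pin : Type
  finite_pin : Finite Pin
  pin : Pin → ℂ
  pin_injective : Function.Injective pin
  gauge_pin : ∀ p, gauge (pin p) = 1

namespace PinnedBody

/-- The closed region itself. -/
def body (X : PinnedBody) : Set ℂ := {z | X.gauge z ≤ 1}

/-- The union of the open rays that start at the origin and pass through the pins. -/
def spokes (X : PinnedBody) : Set ℂ := {z | ∃ (p : X.Pin) (t : ℝ), 0 < t ∧ z = t • X.pin p}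

variable (X : PinnedBody)

theorem gauge_zero : X.gauge 0 = 0 := by simpa using X.gauge_smul 0 0 le_rfl

theorem gauge_nonneg (z : ℂ) : 0 ≤ X.gauge z := by
  by_cases h : z = 0
  · rw [h, X.gauge_zero]
  · exact (X.gauge_pos z h).le

theorem smul_mem_spokes {t : ℝ} (ht : 0 < t) (z : ℂ) : t • z ∈ X.spokes ↔ z ∈ X.spokes := by
  constructor
  · rintro ⟨p, s, hs, h⟩
    refine ⟨p, t⁻¹ * s, by positivity, ?_⟩
    rw [mul_smul, ← h, smul_smul, inv_mul_cancel₀ ht.ne', one_smul]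
  · rintro ⟨p, s, hs, rfl⟩
    exact ⟨p, t * s, by positivity, by rw [mul_smul]⟩

theorem isClosed_le (c : ℝ) : IsClosed {z | X.gauge z ≤ c} :=
  _root_.isClosed_le X.continuous_gauge continuous_const

theorem isCompact_le (c : ℝ) : IsCompact {z | X.gauge z ≤ c} := by
  obtain ⟨w, hw, hmin⟩ := (isCompact_sphere (0 : ℂ) 1).exists_isMinOn
    ⟨1, by simp⟩ X.continuous_gauge.continuousOn
  have hw0 : 0 < X.gauge w := X.gauge_pos w (by rintro rfl; simp at hw)
  refine (isCompact_closedBall (0 : ℂ) (c / X.gauge w)).of_isClosed_subset (X.isClosed_le c) ?_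
  intro z hz
  rw [mem_closedBall_zero_iff, le_div_iff₀ hw0]
  refine le_trans ?_ hz
  by_cases h : z = 0
  · simp [h, X.gauge_zero]
  · have hn : 0 < ‖z‖ := norm_pos_iff.2 h
    have h1 : z = ‖z‖ • (‖z‖⁻¹ • z) := by
      rw [smul_smul, mul_inv_cancel₀ hn.ne', one_smul]
    have h2 : X.gauge w ≤ X.gauge (‖z‖⁻¹ • z) := hmin (by
      rw [mem_sphere_zero_iff_norm, norm_smul, norm_inv, norm_norm, inv_mul_cancel₀ hn.ne'])
    calc ‖z‖ * X.gauge w ≤ ‖z‖ * X.gauge (‖z‖⁻¹ • z) := by gcongr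
      _ = X.gauge z := by rw [← X.gauge_smul _ _ hn.le, ← h1]

theorem exists_enlarge {O : Set ℂ} (hO : IsOpen O) (h : X.body ⊆ O) :
    ∃ c > 1, {z | X.gauge z ≤ c} ⊆ O := by
  have hK : IsCompact ({z | X.gauge z ≤ 2} \ O) := (X.isCompact_le 2).diff hO
  rcases ({z | X.gauge z ≤ 2} \ O).eq_empty_or_nonempty with h0 | h0
  · exact ⟨2, by norm_num, sdiff_eq_empty.1 h0⟩
  · obtain ⟨w, hw, hmin⟩ := hK.exists_isMinOn h0 X.continuous_gauge.continuousOn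
    have hw1 : 1 < X.gauge w := by
      by_contra h'
      exact hw.2 (h (not_lt.1 h'))
    refine ⟨(1 + X.gauge w) / 2, by linarith, ?_⟩
    intro z hz
    by_contra hzO
    have hw2 : X.gauge w ≤ 2 := hw.1
    have hz' : X.gauge z ≤ (1 + X.gauge w) / 2 := hz
    have hmem : z ∈ {z | X.gauge z ≤ 2} \ O := ⟨show X.gauge z ≤ 2 by linarith, hzO⟩
    have : X.gauge w ≤ X.gauge z := hmin hmem
    linarith

/-! ### Radial isotopies -/

/-- The factor by which a point of gauge `s` is moved by the piecewise linear map of radii that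
sends `0`, `a`, `c` to `0`, `b`, `c` and is the identity beyond `c`. -/
noncomputable def radialFactor (a b c s : ℝ) : ℝ :=
  ((c - b) + c * (b - a) / max a (min s c)) / (c - a)

theorem radialFactor_inner {a b c s : ℝ} (ha : 0 < a) (hac : a < c) (h : s ≤ a) :
    radialFactor a b c s = b / a := by
  have h1 : max a (min s c) = a := max_eq_left ((min_le_left _ _).trans h)
  have : c - a ≠ 0 := by linarith
  rw [radialFactor, h1]
  field_simp
  ring

theorem radialFactor_outer {a b c s : ℝ} (ha : 0 < a) (hac : a < c) (h : c ≤ s) :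
    radialFactor a b c s = 1 := by
  have h1 : max a (min s c) = c := by rw [min_eq_right h, max_eq_right hac.le]
  have : c - a ≠ 0 := by linarith
  have : c ≠ 0 := by linarith
  rw [radialFactor, h1]
  field_simp
  ring

theorem radialFactor_mid {a b c s : ℝ} (ha : 0 < a) (hac : a < c) (h : a ≤ s) (h' : s ≤ c) :
    radialFactor a b c s * s = ((c - b) * s + c * (b - a)) / (c - a) := by
  have h1 : max a (min s c) = s := by rw [min_eq_left h', max_eq_right h]
  have : c - a ≠ 0 := by linarith
  have : s ≠ 0 := by linarith
  rw [radialFactor, h1]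
  field_simp

theorem radialFactor_mid_mem {a b c s : ℝ} (ha : 0 < a) (hac : a < c) (hbc : b < c)
    (h : a ≤ s) (h' : s ≤ c) :
    b ≤ radialFactor a b c s * s ∧ radialFactor a b c s * s ≤ c := by
  rw [radialFactor_mid ha hac h h', le_div_iff₀ (by linarith), div_le_iff₀ (by linarith)]
  constructor <;> nlinarith

theorem radialFactor_pos {a b c s : ℝ} (ha : 0 < a) (hac : a < c) (hb : 0 < b) (hbc : b < c) :
    0 < radialFactor a b c s := by
  rcases le_total s a with h | h
  · rw [radialFactor_inner ha hac h]
    positivity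
  · rcases le_total s c with h' | h'
    · have := (radialFactor_mid_mem ha hac hbc h h').1
      have hs : 0 < s := by linarith
      by_contra h0
      have := mul_nonpos_of_nonpos_of_nonneg (not_lt.1 h0) hs.le
      linarith
    · rw [radialFactor_outer ha hac h']
      exact one_pos

theorem radialFactor_inv {a b c s : ℝ} (ha : 0 < a) (hac : a < c) (hb : 0 < b) (hbc : b < c) :
    radialFactor b a c (radialFactor a b c s * s) * radialFactor a b c s = 1 := by
  rcases le_total s a with h | h
  · rw [radialFactor_inner ha hac h, radialFactor_inner hb hbc]
    · field_simp
    · rw [div_mul_eq_mul_div, div_le_iff₀ ha]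
      nlinarith
  · rcases le_total s c with h' | h'
    · have hm := radialFactor_mid_mem ha hac hbc h h'
      have hs : s ≠ 0 := by linarith
      refine mul_right_cancel₀ hs ?_
      rw [mul_assoc, radialFactor_mid hb hbc hm.1 hm.2, radialFactor_mid ha hac h h']
      have : c - a ≠ 0 := by linarith
      have : c - b ≠ 0 := by linarith
      field_simp
      ring
    · rw [radialFactor_outer ha hac h', one_mul, radialFactor_outer hb hbc h', one_mul]

/-- The time-dependent inner radius `b / (1 + t)`. -/
theorem inner_radius {b c : ℝ} (hb : 0 < b) (hbc : b < c) (t : I) :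
    0 < b / (1 + (t : ℝ)) ∧ b / (1 + (t : ℝ)) < c := by
  have ht : 0 ≤ (t : ℝ) := t.2.1
  refine ⟨by positivity, lt_of_le_of_lt ?_ hbc⟩
  rw [div_le_iff₀ (by linarith)]
  nlinarith

/-- An isotopy which moves points radially, is the identity where the gauge is at least `c`, and
finally multiplies by `2` where the gauge is at most `b / 2`. -/
noncomputable def radial {b c : ℝ} (hb : 0 < b) (hbc : b < c) : PlaneIsotopy where
  toHomeo :=
    { toFun := fun x => (x.1, radialFactor (b / (1 + (x.1 : ℝ))) b c (X.gauge x.2) • x.2)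
      invFun := fun x => (x.1, radialFactor b (b / (1 + (x.1 : ℝ))) c (X.gauge x.2) • x.2)
      left_inv := by
        rintro ⟨t, z⟩
        obtain ⟨h1, h2⟩ := inner_radius hb hbc t
        dsimp only
        rw [X.gauge_smul _ _ (radialFactor_pos h1 h2 hb hbc).le, smul_smul,
          radialFactor_inv h1 h2 hb hbc, one_smul]
      right_inv := by
        rintro ⟨t, z⟩
        obtain ⟨h1, h2⟩ := inner_radius hb hbc t
        dsimp only
        rw [X.gauge_smul _ _ (radialFactor_pos hb hbc h1 h2).le, smul_smul,
          radialFactor_inv hb hbc h1 h2, one_smul]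
      continuous_toFun := by
        have h0 : ∀ x : I × ℂ, (1 + (x.1 : ℝ)) ≠ 0 := fun x => by
          have := x.1.2.1
          positivity
        have h1 : ∀ x : I × ℂ, max (b / (1 + (x.1 : ℝ))) (min (X.gauge x.2) c) ≠ 0 :=
          fun x => (lt_max_of_lt_left (inner_radius hb hbc x.1).1).ne'
        have h2 : ∀ x : I × ℂ, c - b / (1 + (x.1 : ℝ)) ≠ 0 := fun x => by
          have := (inner_radius hb hbc x.1).2
          linarith
        have hg := X.continuous_gauge
        unfold radialFactor
        fun_prop (disch := assumption)
      continuous_invFun := by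
        have h0 : ∀ x : I × ℂ, (1 + (x.1 : ℝ)) ≠ 0 := fun x => by
          have := x.1.2.1
          positivity
        have h1 : ∀ x : I × ℂ, max b (min (X.gauge x.2) c) ≠ 0 :=
          fun x => (lt_max_of_lt_left hb).ne'
        have hg := X.continuous_gauge
        unfold radialFactor
        fun_prop (disch := assumption) }
  fst_eq x := rfl
  start z := by
    change ((0 : I), radialFactor (b / (1 + ((0 : I) : ℝ))) b c (X.gauge z) • z) = (0, z)
    have : radialFactor (b / (1 + ((0 : I) : ℝ))) b c (X.gauge z) = 1 := by
      have : c - b ≠ 0 := by linarith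
      simp [radialFactor, this]
    rw [this, one_smul]

section

variable {b c : ℝ} (hb : 0 < b) (hbc : b < c)

theorem radial_eval (t : I) (z : ℂ) :
    (X.radial hb hbc).eval t z = radialFactor (b / (1 + (t : ℝ))) b c (X.gauge z) • z := rfl

theorem radial_outer (t : I) {z : ℂ} (h : c ≤ X.gauge z) : (X.radial hb hbc).eval t z = z := by
  obtain ⟨h1, h2⟩ := inner_radius hb hbc t
  rw [radial_eval, radialFactor_outer h1 h2 h, one_smul]

theorem radial_inner {z : ℂ} (h : X.gauge z ≤ b / 2) :
    (X.radial hb hbc).eval 1 z = (2 : ℝ) • z := by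
  obtain ⟨h1, h2⟩ := inner_radius hb hbc 1
  have h3 : (1 + ((1 : I) : ℝ)) = 2 := by norm_num
  rw [h3] at h1 h2
  rw [radial_eval, h3, radialFactor_inner h1 h2 h]
  congr 1
  field_simp

theorem radial_mem_spokes (t : I) (z : ℂ) :
    (X.radial hb hbc).eval t z ∈ X.spokes ↔ z ∈ X.spokes := by
  obtain ⟨h1, h2⟩ := inner_radius hb hbc t
  exact X.smul_mem_spokes (radialFactor_pos h1 h2 hb hbc) z

theorem radial_mid {z : ℂ} (h : b / 2 ≤ X.gauge z) (h' : X.gauge z ≤ c) :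
    b ≤ X.gauge ((X.radial hb hbc).eval 1 z) ∧ X.gauge ((X.radial hb hbc).eval 1 z) ≤ c := by
  obtain ⟨h1, h2⟩ := inner_radius hb hbc 1
  rw [radial_eval, X.gauge_smul _ _ (radialFactor_pos h1 h2 hb hbc).le]
  have h3 : (1 + ((1 : I) : ℝ)) = 2 := by norm_num
  rw [h3] at h1 h2 ⊢
  exact radialFactor_mid_mem h1 h2 hbc h h'

end

end PinnedBody

/-! ### Planar diagrams -/

/-- Some arc in `S` with `z` in its interior is a neighbourhood of `z` in `S`. -/
def LocalArc (S : Set ℂ) (z : ℂ) : Prop :=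
  ∃ γ : ℝ → ℂ, ContinuousOn γ (Icc (-1) 1) ∧ InjOn γ (Icc (-1) 1) ∧ γ 0 = z ∧
    γ '' Icc (-1) 1 ⊆ S ∧ γ '' Icc (-1) 1 ∈ 𝓝[S] z

/-- A planar diagram with inner bodies `X i` and outer body `Y`. The `i`-th inner body is embedded
in the interior of `Y` by an orientation-preserving homeomorphism of the plane, so that its pins
remain numbered in the same cyclic order; the embedded bodies are disjoint. The strings form a
compact one-dimensional manifold `strings` in the part of `Y` outside of the inner bodies, whose
boundary points are exactly the pins; so its components are arcs between pins and closed loops.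
Strings are attached to the pins perpendicularly, that is, they follow the spokes near the boundary
of each body. -/
structure Diagram {ι : Type} (X : ι → PinnedBody) (Y : PinnedBody) where
  place : ι → ℂ ≃ₜ ℂ
  place_orientation : ∀ i, IsotopicToId (place i)
  place_interior : ∀ i, ∀ z ∈ (X i).body, Y.gauge (place i z) < 1
  place_disjoint : ∀ i j, i ≠ j → Disjoint (place i '' (X i).body) (place j '' (X j).body)
  strings : Set ℂ
  strings_closed : IsClosed strings
  strings_subset : strings ⊆ Y.body
  strings_avoid : ∀ i z, (X i).gauge z < 1 → place i z ∉ strings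
  strings_manifold : ∀ z ∈ strings, Y.gauge z < 1 → (∀ i, z ∉ place i '' (X i).body) →
    LocalArc strings z
  strings_outer : ∃ r < 1, ∀ z, r ≤ Y.gauge z → Y.gauge z ≤ 1 → (z ∈ strings ↔ z ∈ Y.spokes)
  strings_inner : ∀ i, ∃ r > 1, ∀ z, 1 ≤ (X i).gauge z → (X i).gauge z ≤ r →
    (place i z ∈ strings ↔ z ∈ (X i).spokes)

/-- Planar isotopy of diagrams, relative to the boundary of the outer body: an ambient isotopy
carries strings to strings and each inner body, with its pins, to its counterpart. (That it also
matches the two parametrizations of an inner body is no restriction: they differ by an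
orientation-preserving homeomorphism of the body that fixes the pins, which can be undone by an
isotopy in a collar of the body along the strings.) -/
def Diagram.Isotopic {ι : Type} {X : ι → PinnedBody} {Y : PinnedBody} (T T' : Diagram X Y) : Prop :=
  ∃ H : PlaneIsotopy, (∀ t z, 1 ≤ Y.gauge z → H.eval t z = z) ∧
    (∀ i, ∀ z ∈ (X i).body, H.eval 1 (T.place i z) = T'.place i z) ∧
    H.eval 1 '' T.strings = T'.strings

theorem LocalArc.image {S : Set ℂ} {z : ℂ} (h : LocalArc S z) (φ : ℂ ≃ₜ ℂ) :
    LocalArc (φ '' S) (φ z) := by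
  obtain ⟨γ, h1, h2, h3, h4, h5⟩ := h
  refine ⟨φ ∘ γ, φ.continuous.comp_continuousOn h1, φ.injective.comp_injOn h2, by simp [h3], ?_, ?_⟩
  · rw [image_comp]
    exact image_mono h4
  · rw [image_comp]
    have := image_mem_map (m := φ) h5
    rwa [φ.isEmbedding.map_nhdsWithin_eq] at this

theorem LocalArc.mono {S S' : Set ℂ} {z : ℂ} (h : LocalArc S z) (hS : S ⊆ S')
    (hS' : ∀ᶠ w in 𝓝 z, w ∈ S' → w ∈ S) : LocalArc S' z := by
  obtain ⟨γ, h1, h2, h3, h4, h5⟩ := h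
  refine ⟨γ, h1, h2, h3, h4.trans hS, ?_⟩
  rw [mem_nhdsWithin_iff_eventually] at h5 ⊢
  filter_upwards [h5, hS'] with w hw hw' hwS using hw (hw' hwS)

/-- A set that agrees with the spokes near a point of a spoke is an arc there. -/
theorem LocalArc.of_spokes (X : PinnedBody) (φ : ℂ ≃ₜ ℂ) {S : Set ℂ} {x : ℂ} (hx : x ∈ X.spokes)
    (hS : ∀ᶠ w in 𝓝 x, (φ w ∈ S ↔ w ∈ X.spokes)) : LocalArc S (φ x) := by
  obtain ⟨p, t, ht, rfl⟩ := hx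
  have hp0 : X.pin p ≠ 0 := by
    intro h
    have := X.gauge_pin p
    rw [h, X.gauge_zero] at this
    exact zero_ne_one this
  have hcont : Continuous fun s : ℝ => s • X.pin p := by fun_prop
  have hev : ∀ᶠ s in 𝓝 t, 0 < s ∧ (φ (s • X.pin p) ∈ S ↔ s • X.pin p ∈ X.spokes) :=
    (lt_mem_nhds ht).and (hcont.continuousAt.eventually hS)
  obtain ⟨ε, hε, hball⟩ := Metric.eventually_nhds_iff.1 hev
  have hmem : ∀ s ∈ Icc (-1 : ℝ) 1, 0 < t + ε / 2 * s ∧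
      φ ((t + ε / 2 * s) • X.pin p) ∈ S := by
    intro s hs
    obtain ⟨h1, h2⟩ := hball (y := t + ε / 2 * s) (by
      rw [Real.dist_eq, add_sub_cancel_left, abs_mul, abs_of_pos (half_pos hε)]
      have : |s| ≤ 1 := abs_le.2 hs
      nlinarith)
    exact ⟨h1, h2.2 ⟨p, _, h1, rfl⟩⟩
  have himage : (fun s : ℝ => φ ((t + ε / 2 * s) • X.pin p)) '' Icc (-1) 1 ∈
      𝓝[S] (φ (t • X.pin p)) := by
    rw [mem_nhdsWithin_iff_eventually, ← φ.map_nhds_eq, eventually_map]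
    have hg : ContinuousAt (fun w => (X.gauge w)⁻¹ • w) (t • X.pin p) := by
      have := X.continuous_gauge
      refine ContinuousAt.smul (ContinuousAt.inv₀ this.continuousAt ?_) continuousAt_id
      rw [X.gauge_smul _ _ ht.le, X.gauge_pin, mul_one]
      exact ht.ne'
    have hfin : (X.pin '' {q | q ≠ p}).Finite := by
      have := X.finite_pin
      exact Set.toFinite _
    have hval : (X.gauge (t • X.pin p))⁻¹ • (t • X.pin p) = X.pin p := by
      rw [X.gauge_smul _ _ ht.le, X.gauge_pin, mul_one, smul_smul, inv_mul_cancel₀ ht.ne', one_smul]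
    have hne : ∀ᶠ w in 𝓝 (t • X.pin p), (X.gauge w)⁻¹ • w ∉ X.pin '' {q | q ≠ p} := by
      refine hg.eventually (hfin.isClosed.isOpen_compl.mem_nhds ?_)
      rintro ⟨q, hq, hqp⟩
      exact hq (X.pin_injective (hqp.trans hval))
    have hnear : ∀ᶠ w in 𝓝 (t • X.pin p), dist (X.gauge w) t < ε / 2 := by
      have := X.continuous_gauge.continuousAt (x := t • X.pin p)
      rw [ContinuousAt, X.gauge_smul _ _ ht.le, X.gauge_pin, mul_one] at this
      exact this.eventually (Metric.ball_mem_nhds t (half_pos hε))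
    filter_upwards [hS, hne, hnear] with w h1 h2 h3 h4
    obtain ⟨q, s, hs, rfl⟩ := h1.1 h4
    rw [X.gauge_smul _ _ hs.le, X.gauge_pin, mul_one] at h2 h3
    rw [smul_smul, inv_mul_cancel₀ hs.ne', one_smul] at h2
    have hqp : q = p := by
      by_contra hqp
      exact h2 ⟨q, hqp, rfl⟩
    subst hqp
    refine ⟨(s - t) / (ε / 2), ?_, ?_⟩
    · rw [Real.dist_eq, abs_lt] at h3
      rw [mem_Icc, le_div_iff₀ (half_pos hε), div_le_iff₀ (half_pos hε)]
      constructor <;> linarith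
    · dsimp only
      congr 2
      field_simp
      ring
  refine ⟨_, ?_, ?_, ?_, ?_, himage⟩
  · have := φ.continuous
    exact Continuous.continuousOn (by fun_prop)
  · intro s _ s' _ h
    have h1 := smul_left_injective ℝ hp0 (φ.injective h)
    have : ε / 2 ≠ 0 := (half_pos hε).ne'
    exact mul_left_cancel₀ this (add_left_cancel h1)
  · simp
  · rintro _ ⟨s, hs, rfl⟩
    exact (hmem s hs).2

namespace Diagram

theorem Isotopic.refl {ι : Type} {X : ι → PinnedBody} {Y : PinnedBody} (T : Diagram X Y) :
    T.Isotopic T :=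
  ⟨PlaneIsotopy.refl, fun _ _ _ => rfl, fun _ _ _ => rfl, by
    ext
    simp [PlaneIsotopy.eval_refl]⟩

theorem Isotopic.symm {ι : Type} {X : ι → PinnedBody} {Y : PinnedBody} {T T' : Diagram X Y}
    (h : T.Isotopic T') : T'.Isotopic T := by
  obtain ⟨H, h1, h2, h3⟩ := h
  refine ⟨H.symm, ?_, ?_, ?_⟩
  · intro t z hz
    have := H.eval_symm_eval t z
    rwa [h1 t z hz] at this
  · intro i z hz
    rw [← h2 i z hz, H.eval_symm_eval]
  · rw [← h3, image_image]
    simp [H.eval_symm_eval]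

theorem Isotopic.trans {ι : Type} {X : ι → PinnedBody} {Y : PinnedBody} {T T' T'' : Diagram X Y}
    (h : T.Isotopic T') (h' : T'.Isotopic T'') : T.Isotopic T'' := by
  obtain ⟨H, h1, h2, h3⟩ := h
  obtain ⟨G, g1, g2, g3⟩ := h'
  refine ⟨H.trans G, ?_, ?_, ?_⟩
  · intro t z hz
    rw [PlaneIsotopy.eval_trans, h1 t z hz, g1 t z hz]
  · intro i z hz
    rw [PlaneIsotopy.eval_trans, h2 i z hz, g2 i z hz]
  · rw [← g3, ← h3, image_image]
    simp [PlaneIsotopy.eval_trans]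

/-- Diagrams up to planar isotopy. -/
instance setoid {ι : Type} (X : ι → PinnedBody) (Y : PinnedBody) : Setoid (Diagram X Y) where
  r := Isotopic
  iseqv := ⟨Isotopic.refl, Isotopic.symm, Isotopic.trans⟩

/-- Renaming the inner bodies. -/
noncomputable def reindex {ι κ : Type} {X : ι → PinnedBody} {Y : PinnedBody} (T : Diagram X Y) (e : κ ≃ ι) :
    Diagram (fun k => X (e k)) Y where
  place k := T.place (e k)
  place_orientation k := T.place_orientation (e k)
  place_interior k := T.place_interior (e k)
  place_disjoint j k h := T.place_disjoint _ _ (fun h' => h (e.injective h'))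
  strings := T.strings
  strings_closed := T.strings_closed
  strings_subset := T.strings_subset
  strings_avoid k := T.strings_avoid (e k)
  strings_manifold z hz h1 h2 := T.strings_manifold z hz h1 fun i => by
    obtain ⟨k, rfl⟩ := e.surjective i
    exact h2 k
  strings_outer := T.strings_outer
  strings_inner k := T.strings_inner (e k)

theorem isClosed_place {ι : Type} {X : ι → PinnedBody} {Y : PinnedBody} (T : Diagram X Y) (i : ι) :
    IsClosed (T.place i '' (X i).body) :=
  (T.place i).isClosedMap _ ((X i).isClosed_le 1)

section

variable {ι : Type} [Finite ι] {X : ι → PinnedBody} {Y : PinnedBody}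

/-- Near the outer boundary there are only spokes and no inner bodies. -/
theorem exists_outer (T : Diagram X Y) : ∃ r, 0 < r ∧ r < 1 ∧
    (∀ z, r ≤ Y.gauge z → Y.gauge z ≤ 1 → (z ∈ T.strings ↔ z ∈ Y.spokes)) ∧
    ∀ i, ∀ z ∈ (X i).body, Y.gauge (T.place i z) ≤ r := by
  obtain ⟨r, hr, h⟩ := T.strings_outer
  have hK : IsCompact (insert 0 (⋃ i, T.place i '' (X i).body)) :=
    (isCompact_iUnion fun i => ((X i).isCompact_le 1).image (T.place i).continuous).insert 0
  obtain ⟨w, hw, hmax⟩ := hK.exists_isMaxOn ⟨0, mem_insert _ _⟩ Y.continuous_gauge.continuousOn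
  have hw1 : Y.gauge w < 1 := by
    rcases hw with rfl | hw
    · rw [Y.gauge_zero]
      exact one_pos
    · obtain ⟨i, z, hz, rfl⟩ := mem_iUnion.1 hw
      exact T.place_interior i z hz
  refine ⟨max (1 / 2) (max r (Y.gauge w)), lt_max_of_lt_left (by norm_num), ?_, ?_, ?_⟩
  · exact max_lt (by norm_num) (max_lt hr hw1)
  · intro z hz
    exact h z (le_trans (le_trans (le_max_left _ _) (le_max_right _ _)) hz)
  · intro i z hz
    refine le_trans ?_ (le_trans (le_max_right _ _) (le_max_right _ _))
    exact hmax (mem_insert_of_mem _ (mem_iUnion.2 ⟨i, z, hz, rfl⟩))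

/-- The inner bodies have disjoint collars in which the strings are spokes. -/
theorem exists_inner (T : Diagram X Y) : ∃ c : ι → ℝ, (∀ i, 1 < c i) ∧
    (∀ i z, 1 ≤ (X i).gauge z → (X i).gauge z ≤ c i →
      (T.place i z ∈ T.strings ↔ z ∈ (X i).spokes)) ∧
    (∀ i z, (X i).gauge z ≤ c i → Y.gauge (T.place i z) < 1) ∧
    ∀ i j, i ≠ j → Disjoint (T.place i '' {z | (X i).gauge z ≤ c i})
      (T.place j '' {z | (X j).gauge z ≤ c j}) := by
  have hcpt : ∀ i, IsCompact (T.place i '' (X i).body) := fun i =>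
    ((X i).isCompact_le 1).image (T.place i).continuous
  have hsep : ∀ i j, ∃ U V : Set ℂ, IsOpen U ∧ IsOpen V ∧ (i ≠ j → T.place i '' (X i).body ⊆ U ∧
      T.place j '' (X j).body ⊆ V ∧ Disjoint U V) := by
    intro i j
    by_cases h : i = j
    · exact ⟨univ, univ, isOpen_univ, isOpen_univ, fun h' => absurd h h'⟩
    · obtain ⟨U, V, hU, hV, h1, h2, h3⟩ :=
        SeparatedNhds.of_isCompact_isCompact (hcpt i) (hcpt j) (T.place_disjoint i j h)
      exact ⟨U, V, hU, hV, fun _ => ⟨h1, h2, h3⟩⟩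
  choose U V hU hV hUV using hsep
  have hc : ∀ i, ∃ c > 1, {z | (X i).gauge z ≤ c} ⊆
      T.place i ⁻¹' ({z | Y.gauge z < 1} ∩ ⋂ j, {z | i ≠ j → z ∈ U i j ∩ V j i}) := by
    intro i
    refine (X i).exists_enlarge (IsOpen.preimage (T.place i).continuous (IsOpen.inter
      (isOpen_lt Y.continuous_gauge continuous_const) (isOpen_iInter_of_finite fun j => ?_))) ?_
    · by_cases h : i = j
      · simp [h]
      · simpa [h] using (hU i j).inter (hV j i)
    · intro z hz
      refine ⟨T.place_interior i z hz, mem_iInter.2 fun j h => ⟨?_, ?_⟩⟩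
      · exact (hUV i j h).1 ⟨z, hz, rfl⟩
      · exact (hUV j i h.symm).2.1 ⟨z, hz, rfl⟩
  choose c hc1 hc using hc
  choose r hr1 hr using T.strings_inner
  refine ⟨fun i => min (c i) (r i), fun i => lt_min (hc1 i) (hr1 i), ?_, ?_, ?_⟩
  · intro i z h1 h2
    exact hr i z h1 (h2.trans (min_le_right _ _))
  · intro i z h
    exact (hc i (show (X i).gauge z ≤ c i from h.trans (min_le_left _ _))).1
  · intro i j hij
    rw [disjoint_left]
    rintro _ ⟨z, hz, rfl⟩ ⟨w, hw, hwz⟩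
    have h1 := (mem_iInter.1 (hc i (show (X i).gauge z ≤ c i from le_trans hz (min_le_left _ _))).2 j hij).1
    have h2 := (mem_iInter.1 (hc j (show (X j).gauge w ≤ c j from le_trans hw (min_le_left _ _))).2 i hij.symm).2
    rw [hwz] at h2
    exact disjoint_left.1 (hUV i j hij).2.2 h1 h2

end


/-- The strings of the plugged diagram, seen inside of the `i`-th inner body. -/
theorem plug_strings_iff {ι : Type} {X : ι → PinnedBody} {Y : PinnedBody} {κ : ι → Type}
    {Z : (i : ι) → κ i → PinnedBody} (T : Diagram X Y) (U : (i : ι) → Diagram (Z i) (X i)) {i : ι} {x : ℂ}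
    (hx : ∀ j, i ≠ j → T.place i x ∉ T.place j '' (X j).body) :
    T.place i x ∈ T.strings ∪ ⋃ j, T.place j '' (U j).strings ↔
      T.place i x ∈ T.strings ∨ x ∈ (U i).strings := by
  constructor
  · rintro (h | h)
    · exact Or.inl h
    · obtain ⟨j, y, hy, hyx⟩ := mem_iUnion.1 h
      by_cases hij : i = j
      · subst hij
        exact Or.inr ((T.place i).injective hyx ▸ hy)
      · exact absurd ⟨y, (U j).strings_subset hy, hyx⟩ (hx j hij)
  · rintro (h | h)
    · exact Or.inl h
    · exact Or.inr (mem_iUnion.2 ⟨i, x, h, rfl⟩)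

section Plug

variable {ι : Type} [Finite ι] {X : ι → PinnedBody} {Y : PinnedBody} {κ : ι → Type}
  [∀ i, Finite (κ i)] {Z : (i : ι) → κ i → PinnedBody}

/-- Plugging the diagrams `U i` into the inner bodies of `T`. -/
noncomputable def plug (T : Diagram X Y) (U : (i : ι) → Diagram (Z i) (X i)) :
    Diagram (fun p : (i : ι) × κ i => Z p.1 p.2) Y where
  place p := ((U p.1).place p.2).trans (T.place p.1)
  place_orientation p := ((U p.1).place_orientation p.2).trans (T.place_orientation p.1)
  place_interior p z hz := T.place_interior p.1 _ ((U p.1).place_interior p.2 z hz).le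
  place_disjoint := by
    rintro ⟨i, j⟩ ⟨i', j'⟩ h
    rw [disjoint_left]
    rintro _ ⟨z, hz, rfl⟩ ⟨w, hw, hwz⟩
    dsimp only [Homeomorph.trans_apply] at hz hw hwz
    have hz' := ((U i).place_interior j z hz).le
    have hw' := ((U i').place_interior j' w hw).le
    by_cases hi : i = i'
    · subst hi
      have hj : j ≠ j' := fun hj => h (by rw [hj])
      exact disjoint_left.1 ((U i).place_disjoint j j' hj) ⟨z, hz, rfl⟩
        ⟨w, hw, (T.place i).injective hwz⟩
    · exact disjoint_left.1 (T.place_disjoint i i' hi) ⟨_, hz', rfl⟩ ⟨_, hw', hwz⟩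
  strings := T.strings ∪ ⋃ i, T.place i '' (U i).strings
  strings_closed := T.strings_closed.union
    (isClosed_iUnion_of_finite fun i => (T.place i).isClosedMap _ (U i).strings_closed)
  strings_subset := by
    refine union_subset T.strings_subset (iUnion_subset fun i => ?_)
    rintro _ ⟨z, hz, rfl⟩
    exact (T.place_interior i z ((U i).strings_subset hz)).le
  strings_avoid := by
    rintro ⟨i, j⟩ z hz
    have hz' := (U i).place_interior j z hz.le
    change T.place i ((U i).place j z) ∉ _
    rw [T.plug_strings_iff U]
    · rintro (h | h)
      · exact T.strings_avoid i _ hz' h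
      · exact (U i).strings_avoid j z hz h
    · intro j' hj' hmem
      exact disjoint_left.1 (T.place_disjoint i j' hj') ⟨_, hz'.le, rfl⟩ hmem
  strings_manifold := by
    intro z hz hz1 hz2
    by_cases hb : ∃ i, z ∈ T.place i '' (X i).body
    · obtain ⟨i, x, hx, rfl⟩ := hb
      obtain ⟨c, hc1, hc2, hc3, hc4⟩ := T.exists_inner
      have hdisj : ∀ w, (X i).gauge w ≤ c i → ∀ j, i ≠ j →
          T.place i w ∉ T.place j '' (X j).body := by
        rintro w hw j hij ⟨y, hy, hyw⟩
        exact disjoint_left.1 (hc4 i j hij) ⟨w, hw, rfl⟩ ⟨y, le_trans hy (hc1 j).le, hyw⟩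
      have hx1 : (X i).gauge x ≤ 1 := hx
      rw [T.plug_strings_iff U (hdisj x (hx1.trans (hc1 i).le))] at hz
      rcases hx1.lt_or_eq with hlt | heq
      · have hxU : x ∈ (U i).strings := hz.resolve_left (T.strings_avoid i x hlt)
        refine LocalArc.mono (((U i).strings_manifold x hxU hlt ?_).image (T.place i)) ?_ ?_
        · rintro j ⟨y, hy, hyx⟩
          exact hz2 ⟨i, j⟩ ⟨y, hy, congrArg (T.place i) hyx⟩
        · exact fun w hw => Or.inr (mem_iUnion.2 ⟨i, hw⟩)
        · rw [← (T.place i).map_nhds_eq, eventually_map]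
          filter_upwards [(isOpen_lt (X i).continuous_gauge continuous_const).mem_nhds hlt]
            with w hw hwS
          have hw1 : (X i).gauge w < 1 := hw
          rw [T.plug_strings_iff U (hdisj w (hw1.le.trans (hc1 i).le))] at hwS
          exact ⟨w, hwS.resolve_left (T.strings_avoid i w hw1), rfl⟩
      · obtain ⟨r, -, hr1, hr, -⟩ := (U i).exists_outer
        refine LocalArc.of_spokes (X i) (T.place i) ?_ ?_
        · rcases hz with hz | hz
          · exact (hc2 i x heq.ge (heq.le.trans (hc1 i).le)).1 hz
          · exact (hr x (heq ▸ hr1.le) heq.le).1 hz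
        · have h1 : ∀ᶠ w in 𝓝 x, r < (X i).gauge w :=
            (isOpen_lt continuous_const (X i).continuous_gauge).mem_nhds (show r < _ by rwa [heq])
          have h2 : ∀ᶠ w in 𝓝 x, (X i).gauge w < c i :=
            (isOpen_lt (X i).continuous_gauge continuous_const).mem_nhds
              (show _ < c i by rw [heq]; exact hc1 i)
          filter_upwards [h1, h2] with w hw1 hw2
          rw [T.plug_strings_iff U (hdisj w hw2.le)]
          rcases lt_trichotomy ((X i).gauge w) 1 with h | h | h
          · rw [or_iff_right (T.strings_avoid i w h)]
            exact hr w hw1.le h.le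
          · rw [hr w hw1.le h.le, hc2 i w h.ge hw2.le, or_self]
          · rw [or_iff_left fun hU => absurd ((U i).strings_subset hU) (not_le.2 h)]
            exact hc2 i w h.le hw2.le
    · push Not at hb
      have hout : ∀ w, (∀ i, w ∉ T.place i '' (X i).body) →
          w ∈ T.strings ∪ ⋃ i, T.place i '' (U i).strings → w ∈ T.strings := by
        rintro w hw (h | h)
        · exact h
        · obtain ⟨i, y, hy, hyw⟩ := mem_iUnion.1 h
          exact absurd ⟨y, (U i).strings_subset hy, hyw⟩ (hw i)
      refine (T.strings_manifold z (hout z hb hz) hz1 hb).mono subset_union_left ?_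
      have : ∀ᶠ w in 𝓝 z, ∀ i, w ∉ T.place i '' (X i).body :=
        eventually_all.2 fun i => (T.isClosed_place i).isOpen_compl.mem_nhds (hb i)
      filter_upwards [this] with w hw using hout w hw
  strings_outer := by
    obtain ⟨r, -, hr1, hr, hr2⟩ := T.exists_outer
    refine ⟨(1 + r) / 2, by linarith, fun z hz hz' => ?_⟩
    rw [← hr z (by linarith) hz']
    refine ⟨fun h => h.resolve_right fun h' => ?_, Or.inl⟩
    obtain ⟨i, y, hy, rfl⟩ := mem_iUnion.1 h'
    have := hr2 i y ((U i).strings_subset hy)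
    linarith
  strings_inner := by
    rintro ⟨i, j⟩
    obtain ⟨c, hc1, hc2, hc3, -⟩ := (U i).exists_inner
    refine ⟨c j, hc1 j, fun z hz hz' => ?_⟩
    have hlt := hc3 j z hz'
    rw [← hc2 j z hz hz']
    change T.place i ((U i).place j z) ∈ _ ↔ _
    rw [T.plug_strings_iff U, or_iff_right (T.strings_avoid i _ hlt)]
    intro j' hj' hmem
    exact disjoint_left.1 (T.place_disjoint i j' hj') ⟨_, hlt.le, rfl⟩ hmem

/-- Plugging is compatible with planar isotopy. -/
theorem plug_isotopic {T T' : Diagram X Y} {U U' : (i : ι) → Diagram (Z i) (X i)}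
    (h : T.Isotopic T') (h' : ∀ i, (U i).Isotopic (U' i)) :
    (T.plug U).Isotopic (T'.plug U') := by
  obtain ⟨H, h1, h2, h3⟩ := h
  choose G g1 g2 g3 using h'
  obtain ⟨K, k1, k2⟩ := PlaneIsotopy.exists_glue T'.place (fun i => (X i).body) T'.place_disjoint G
    (fun i t z hz => g1 i t z (not_le.1 hz).le)
  refine ⟨H.trans K, ?_, ?_, ?_⟩
  · intro t z hz
    rw [PlaneIsotopy.eval_trans, h1 t z hz, k2]
    rintro i ⟨x, hx, rfl⟩
    exact absurd (T'.place_interior i x hx) (not_lt.2 hz)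
  · rintro ⟨i, j⟩ z hz
    rw [PlaneIsotopy.eval_trans]
    have hz' := ((U i).place_interior j z hz).le
    change K.eval 1 (H.eval 1 (T.place i ((U i).place j z))) = T'.place i ((U' i).place j z)
    rw [h2 i _ hz', k1 i 1 _ hz', g2 i j z hz]
  · have hK : ∀ z ∈ T'.strings, K.eval 1 z = z := by
      intro z hz
      by_cases hb : ∃ i, z ∈ T'.place i '' (X i).body
      · obtain ⟨i, x, hx, rfl⟩ := hb
        have hx1 : 1 ≤ (X i).gauge x := not_lt.1 fun hlt => T'.strings_avoid i x hlt hz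
        rw [k1 i 1 x hx, g1 i 1 x hx1]
      · push Not at hb
        exact k2 1 z hb
    have hfun : (H.trans K).eval 1 = K.eval 1 ∘ H.eval 1 :=
      funext fun z => PlaneIsotopy.eval_trans H K 1 z
    change (H.trans K).eval 1 '' (T.strings ∪ ⋃ i, T.place i '' (U i).strings) =
      T'.strings ∪ ⋃ i, T'.place i '' (U' i).strings
    rw [hfun, image_comp, image_union, h3, image_union, image_congr hK, image_id', image_iUnion,
      image_iUnion]
    congr 1
    refine iUnion_congr fun i => ?_
    rw [← g3 i, image_image, image_image, image_image]
    refine image_congr fun z hz => ?_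
    have hz' := (U i).strings_subset hz
    rw [h2 i z hz', k1 i 1 z hz']

end Plug

/-! ### The identity diagrams -/

/-- Multiplication by `1 / 2`. -/
noncomputable def half : ℂ ≃ₜ ℂ := Homeomorph.smulOfNeZero (1 / 2 : ℝ) (by norm_num)

theorem half_apply (z : ℂ) : half z = (1 / 2 : ℝ) • z := rfl

theorem half_isotopicToId : IsotopicToId half := by
  have h0 : ∀ t : I, (1 - (t : ℝ) / 2) ≠ 0 := fun t => by
    have := t.2.2
    linarith
  refine ⟨⟨⟨⟨fun x => (x.1, (1 - (x.1 : ℝ) / 2) • x.2),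
    fun x => (x.1, (1 - (x.1 : ℝ) / 2)⁻¹ • x.2), ?_, ?_⟩, ?_, ?_⟩, fun _ => rfl, ?_⟩, ?_⟩
  · rintro ⟨t, z⟩
    dsimp only
    rw [smul_smul, inv_mul_cancel₀ (h0 t), one_smul]
  · rintro ⟨t, z⟩
    dsimp only
    rw [smul_smul, mul_inv_cancel₀ (h0 t), one_smul]
  · dsimp only
    fun_prop
  · dsimp only
    have h1 : ∀ x : I × ℂ, (1 - (x.1 : ℝ) / 2) ≠ 0 := fun x => h0 x.1
    fun_prop (disch := assumption)
  · intro z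
    change ((0 : I), (1 - ((0 : I) : ℝ) / 2) • z) = (0, z)
    simp
  · intro z
    change (1 - ((1 : I) : ℝ) / 2) • z = (1 / 2 : ℝ) • z
    norm_num

theorem gauge_half (X : PinnedBody) (z : ℂ) : X.gauge (half z) = X.gauge z / 2 := by
  rw [half_apply, X.gauge_smul _ _ (by norm_num)]
  ring

theorem half_mem_spokes (X : PinnedBody) (z : ℂ) : half z ∈ X.spokes ↔ z ∈ X.spokes :=
  X.smul_mem_spokes (by norm_num) z

theorem spokes_closed (X : PinnedBody) :
    IsClosed {z | z ∈ X.spokes ∧ 1 / 2 ≤ X.gauge z ∧ X.gauge z ≤ 1} := by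
  have : {z | z ∈ X.spokes ∧ 1 / 2 ≤ X.gauge z ∧ X.gauge z ≤ 1} =
      ⋃ p : X.Pin, (fun t : ℝ => t • X.pin p) '' Icc (1 / 2) 1 := by
    ext z
    simp only [mem_ofPred_eq, mem_iUnion]
    constructor
    · rintro ⟨⟨p, t, ht, rfl⟩, h1, h2⟩
      rw [X.gauge_smul _ _ ht.le, X.gauge_pin, mul_one] at h1 h2
      exact ⟨p, t, ⟨h1, h2⟩, rfl⟩
    · rintro ⟨p, t, ⟨h1, h2⟩, rfl⟩
      have ht : 0 < t := by linarith
      refine ⟨⟨p, t, ht, rfl⟩, ?_⟩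
      dsimp only
      rw [X.gauge_smul _ _ ht.le, X.gauge_pin, mul_one]
      exact ⟨h1, h2⟩
  rw [this]
  have := X.finite_pin
  exact isClosed_iUnion_of_finite fun p => (isCompact_Icc.image (by fun_prop)).isClosed

/-- The identity diagram: a half-size copy of `X` inside of `X`, and spokes. -/
noncomputable def ident (X : PinnedBody) : Diagram (fun _ : Fin 1 => X) X where
  place _ := half
  place_orientation _ := half_isotopicToId
  place_interior _ z hz := by
    have hz' : X.gauge z ≤ 1 := hz
    rw [gauge_half]
    linarith
  place_disjoint i j h := absurd (Subsingleton.elim i j) h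
  strings := {z | z ∈ X.spokes ∧ 1 / 2 ≤ X.gauge z ∧ X.gauge z ≤ 1}
  strings_closed := spokes_closed X
  strings_subset z hz := hz.2.2
  strings_avoid _ z hz h := by
    have := h.2.1
    rw [gauge_half] at this
    linarith
  strings_manifold z hz h1 h2 := by
    have hgt : 1 / 2 < X.gauge z := by
      refine lt_of_le_of_ne hz.2.1 fun h => h2 0 ⟨(2 : ℝ) • z, ?_, ?_⟩
      · change X.gauge ((2 : ℝ) • z) ≤ 1
        rw [X.gauge_smul _ _ (by norm_num), ← h]
        norm_num
      · rw [half_apply, smul_smul]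
        norm_num
    refine LocalArc.of_spokes X (Homeomorph.refl ℂ) hz.1 ?_
    filter_upwards [(isOpen_lt continuous_const X.continuous_gauge).mem_nhds hgt,
      (isOpen_lt X.continuous_gauge continuous_const).mem_nhds h1] with w hw1 hw2
    exact ⟨fun h => h.1, fun h => ⟨h, le_of_lt hw1, le_of_lt hw2⟩⟩
  strings_outer := ⟨1 / 2, by norm_num, fun z h1 h2 => ⟨fun h => h.1, fun h => ⟨h, h1, h2⟩⟩⟩
  strings_inner _ := ⟨2, by norm_num, fun z h1 h2 => by
    change (half z ∈ X.spokes ∧ _) ↔ _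
    rw [half_mem_spokes, gauge_half]
    exact ⟨fun h => h.1, fun h => ⟨h, by linarith, by linarith⟩⟩⟩

/-! ### The multicategory of planar diagrams -/

/-- Equality of classes of diagrams whose sequences of inputs are not definitionally equal. -/
theorem mk_heq {d d' : ℕ} {X : Fin d → PinnedBody} {X' : Fin d' → PinnedBody} {Y : PinnedBody}
    (hd : d = d') (hX : ∀ i, X i = X' (Fin.cast hd i)) (T : Diagram X Y) (T' : Diagram X' Y)
    (H : PlaneIsotopy) (h1 : ∀ t z, 1 ≤ Y.gauge z → H.eval t z = z)
    (h2 : ∀ i, ∀ z ∈ (X i).body, H.eval 1 (T.place i z) = T'.place (Fin.cast hd i) z)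
    (h3 : H.eval 1 '' T.strings = T'.strings) :
    HEq (Quotient.mk (setoid X Y) T) (Quotient.mk (setoid X' Y) T') := by
  subst hd
  obtain rfl : X = X' := funext hX
  exact heq_of_eq (Quotient.sound ⟨H, h1, h2, h3⟩)

/-- Plugging of isotopy classes. -/
noncomputable def plugClass {d : ℕ} {X : Fin d → PinnedBody} {Y : PinnedBody} {e : Fin d → ℕ}
    {Z : (i : Fin d) → Fin (e i) → PinnedBody} (T : Quotient (setoid X Y))
    (U : (i : Fin d) → Quotient (setoid (Z i) (X i))) : Quotient (setoid (concat Z) Y) :=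
  Quotient.mk _ ((plug T.out fun i => (U i).out).reindex finSigmaFinEquiv.symm)

theorem plugClass_mk {d : ℕ} {X : Fin d → PinnedBody} {Y : PinnedBody} {e : Fin d → ℕ}
    {Z : (i : Fin d) → Fin (e i) → PinnedBody} (T : Diagram X Y)
    (U : (i : Fin d) → Diagram (Z i) (X i)) :
    plugClass (Quotient.mk (setoid X Y) T) (fun i => Quotient.mk (setoid (Z i) (X i)) (U i)) =
      Quotient.mk (setoid (concat Z) Y) ((plug T U).reindex finSigmaFinEquiv.symm) := by
  obtain ⟨H, h1, h2, h3⟩ := plug_isotopic (Z := Z) (Quotient.mk_out T : Isotopic _ T)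
    (fun i => (Quotient.mk_out (U i) : Isotopic _ (U i)))
  exact Quotient.sound ⟨H, h1, fun k => h2 _, h3⟩

theorem plugClass_ident {d : ℕ} {X : Fin d → PinnedBody} {Y : PinnedBody}
    (T : Quotient (setoid X Y)) :
    HEq (plugClass T fun i => Quotient.mk (setoid _ _) (ident (X i))) T := by
  induction T using Quotient.inductionOn with | h T => ?_
  rw [plugClass_mk]
  have hs : ∀ l : Fin (∑ _ : Fin d, 1), (finSigmaFinEquiv.symm l).1 = Fin.cast (by simp) l := by
    intro l
    obtain ⟨⟨i, j⟩, rfl⟩ := finSigmaFinEquiv.surjective l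
    rw [Equiv.symm_apply_apply]
    obtain rfl : j = 0 := Subsingleton.elim _ _
    exact Fin.ext (finSigma_one d i).symm
  obtain ⟨c, hc1, hc2, hc3, hc4⟩ := T.exists_inner
  obtain ⟨K, k1, k2⟩ := PlaneIsotopy.exists_glue T.place (fun i => {z | (X i).gauge z ≤ c i}) hc4
    (fun i => (X i).radial one_pos (hc1 i))
    (fun i t z hz => (X i).radial_outer _ _ t (not_le.1 hz).le)
  refine mk_heq (by simp) (fun l => congrArg X (hs l)) _ _ K ?_ ?_ ?_
  · intro t z hz
    refine k2 t z ?_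
    rintro i ⟨x, hx, rfl⟩
    exact absurd (hc3 i x hx) (not_lt.2 hz)
  · intro l z hz
    rw [← hs l]
    change K.eval 1 (T.place (finSigmaFinEquiv.symm l).1 (half z)) = _
    generalize (finSigmaFinEquiv.symm l).1 = i at hz ⊢
    have hz' : (X i).gauge z ≤ 1 := hz
    have hh : (X i).gauge (half z) ≤ 1 / 2 := by
      rw [gauge_half]
      linarith
    rw [k1 i 1 _ (show (X i).gauge (half z) ≤ c i by have := hc1 i; linarith),
      (X i).radial_inner _ _ hh, half_apply, smul_smul]
    norm_num
  · refine K.image_eq_of_iff fun w => ?_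
    change w ∈ T.strings ∪ ⋃ i, T.place i '' (ident (X i)).strings ↔ _
    by_cases hw : ∃ i, w ∈ T.place i '' {z | (X i).gauge z ≤ c i}
    · obtain ⟨i, x, hx, rfl⟩ := hw
      have hx' : (X i).gauge x ≤ c i := hx
      rw [T.plug_strings_iff (fun i => ident (X i)), k1 i 1 x hx]
      · rcases lt_or_ge ((X i).gauge x) (1 / 2) with h | h
        · have h1 : T.place i x ∉ T.strings := T.strings_avoid i x (by linarith)
          have h2 : T.place i (((X i).radial one_pos (hc1 i)).eval 1 x) ∉ T.strings := by
            refine T.strings_avoid i _ ?_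
            rw [(X i).radial_inner _ _ h.le, (X i).gauge_smul _ _ (by norm_num)]
            linarith
          have h3 : x ∉ (ident (X i)).strings := fun h' => absurd h'.2.1 (not_le.2 h)
          tauto
        · obtain ⟨m1, m2⟩ := (X i).radial_mid one_pos (hc1 i) h hx'
          rw [hc2 i _ m1 m2, PinnedBody.radial_mem_spokes]
          rcases lt_or_ge ((X i).gauge x) 1 with h' | h'
          · rw [or_iff_right (T.strings_avoid i x h')]
            exact ⟨fun h => h.1, fun h'' => ⟨h'', h, h'.le⟩⟩
          · rw [hc2 i x h' hx']
            exact ⟨fun h => h.elim (fun h => h) (fun h => h.1), Or.inl⟩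
      · rintro j hij ⟨y, hy, hyx⟩
        exact disjoint_left.1 (hc4 i j hij) ⟨x, hx, rfl⟩ ⟨y, le_trans hy (hc1 j).le, hyx⟩
    · push Not at hw
      rw [k2 1 w hw]
      refine or_iff_left fun h => ?_
      obtain ⟨i, y, hy, hyw⟩ := mem_iUnion.1 h
      exact hw i ⟨y, le_trans hy.2.2 (hc1 i).le, hyw⟩

theorem ident_plugClass {d : ℕ} {X : Fin d → PinnedBody} {Y : PinnedBody}
    (T : Quotient (setoid X Y)) :
    HEq (plugClass (Quotient.mk (setoid _ _) (ident Y)) fun _ => T) T := by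
  induction T using Quotient.inductionOn with | h T => ?_
  rw [plugClass_mk]
  have hs : ∀ l : Fin (∑ _ : Fin 1, d), (finSigmaFinEquiv.symm l).2 = Fin.cast (by simp) l := by
    intro l
    obtain ⟨⟨i, j⟩, rfl⟩ := finSigmaFinEquiv.surjective l
    rw [Equiv.symm_apply_apply]
    exact Fin.ext (finSigmaFinEquiv_one _).symm
  obtain ⟨r, hr0, hr1, hr2, hr3⟩ := T.exists_outer
  refine mk_heq (by simp) (fun l => congrArg X (hs l)) _ _ (Y.radial hr0 hr1) ?_ ?_ ?_
  · exact fun t z hz => Y.radial_outer _ _ t hz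
  · intro l z hz
    rw [← hs l]
    change (Y.radial hr0 hr1).eval 1 (half (T.place (finSigmaFinEquiv.symm l).2 z)) = _
    have := hr3 (finSigmaFinEquiv.symm l).2 z hz
    rw [Y.radial_inner, half_apply, smul_smul]
    · norm_num
    · rw [gauge_half]
      linarith
  · refine PlaneIsotopy.image_eq_of_iff _ fun w => ?_
    change w ∈ (ident Y).strings ∪ ⋃ i : Fin 1, half '' T.strings ↔ _
    have hw : w ∈ ⋃ _ : Fin 1, half '' T.strings ↔ (2 : ℝ) • w ∈ T.strings := by
      rw [mem_iUnion]
      constructor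
      · rintro ⟨-, y, hy, rfl⟩
        rw [half_apply, smul_smul]
        norm_num
        exact hy
      · intro h
        refine ⟨0, _, h, ?_⟩
        rw [half_apply, smul_smul]
        norm_num
    have h2 : Y.gauge ((2 : ℝ) • w) = 2 * Y.gauge w := Y.gauge_smul _ _ (by norm_num)
    have hs2 := Y.smul_mem_spokes (show (0 : ℝ) < 2 by norm_num) w
    rw [mem_union, hw]
    rcases le_total (Y.gauge w) (r / 2) with h | h
    · rw [Y.radial_inner _ _ h]
      refine or_iff_right fun h' => ?_
      have := h'.2.1
      linarith
    · rcases le_or_gt (Y.gauge w) 1 with h' | h'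
      · obtain ⟨m1, m2⟩ := Y.radial_mid hr0 hr1 h h'
        rw [hr2 _ m1 m2, PinnedBody.radial_mem_spokes]
        rcases lt_or_ge (Y.gauge w) (1 / 2) with h3 | h3
        · rw [hr2 _ (by linarith) (by linarith), hs2]
          exact ⟨fun h => h.elim (fun h => h.1) (fun h => h), Or.inr⟩
        · constructor
          · rintro (h4 | h4)
            · exact h4.1
            · have h5 : Y.gauge ((2 : ℝ) • w) ≤ 1 := T.strings_subset h4
              exact hs2.1 ((hr2 _ (by linarith) h5).1 h4)
          · exact fun h4 => Or.inl ⟨h4, h3, h'⟩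
      · rw [Y.radial_outer _ _ _ h'.le]
        constructor
        · rintro (h4 | h4)
          · exact absurd h4.2.2 (not_le.2 h')
          · have h5 : Y.gauge ((2 : ℝ) • w) ≤ 1 := T.strings_subset h4
            linarith
        · intro h4
          exact absurd (T.strings_subset h4) (not_le.2 h')

theorem plugClass_assoc {d : ℕ} {X : Fin d → PinnedBody} {Y : PinnedBody} {e : Fin d → ℕ}
    {Z : (i : Fin d) → Fin (e i) → PinnedBody} {f : (i : Fin d) → Fin (e i) → ℕ}
    {V : (i : Fin d) → (j : Fin (e i)) → Fin (f i j) → PinnedBody}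
    (T : Quotient (setoid X Y)) (U : (i : Fin d) → Quotient (setoid (Z i) (X i)))
    (W : (i : Fin d) → (j : Fin (e i)) → Quotient (setoid (V i j) (Z i j))) :
    HEq (plugClass (plugClass T U)
        (fun k => W (finSigmaFinEquiv.symm k).1 (finSigmaFinEquiv.symm k).2))
      (plugClass T (fun i => plugClass (U i) (W i))) := by
  induction T using Quotient.inductionOn with | h T => ?_
  obtain ⟨U, rfl⟩ : ∃ U' : (i : Fin d) → Diagram (Z i) (X i),
      U = fun i => Quotient.mk (setoid (Z i) (X i)) (U' i) :=
    ⟨fun i => (U i).out, funext fun i => (Quotient.out_eq _).symm⟩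
  obtain ⟨W, rfl⟩ : ∃ W' : (i : Fin d) → (j : Fin (e i)) → Diagram (V i j) (Z i j),
      W = fun i j => Quotient.mk (setoid (V i j) (Z i j)) (W' i j) :=
    ⟨fun i j => (W i j).out, funext fun i => funext fun j => (Quotient.out_eq _).symm⟩
  simp only [plugClass_mk]
  have hs : ∀ n : Fin (∑ k, concat f k), ∀ n' : Fin (∑ i, ∑ j, f i j), (n : ℕ) = n' →
      (⟨(finSigmaFinEquiv.symm (finSigmaFinEquiv.symm n).1).1,
        ⟨(finSigmaFinEquiv.symm (finSigmaFinEquiv.symm n).1).2, (finSigmaFinEquiv.symm n).2⟩⟩ :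
        (i : Fin d) × (j : Fin (e i)) × Fin (f i j)) =
      ⟨(finSigmaFinEquiv.symm n').1, finSigmaFinEquiv.symm (finSigmaFinEquiv.symm n').2⟩ := by
    intro n n' h
    obtain ⟨⟨k, l⟩, rfl⟩ := finSigmaFinEquiv.surjective n
    obtain rfl := Fin.ext (h.symm.trans (finSigma_assoc k l))
    rw [Equiv.symm_apply_apply, Equiv.symm_apply_apply]
    dsimp only
    rw [Equiv.symm_apply_apply]
  refine mk_heq (finSigma_assoc_card f) (fun n => congrArg (fun q => V q.1 q.2.1 q.2.2)
    (hs n _ rfl)) _ _ PlaneIsotopy.refl (fun _ _ _ => rfl) ?_ ?_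
  · intro n z _
    exact congrArg (fun q : (i : Fin d) × (j : Fin (e i)) × Fin (f i j) =>
      T.place q.1 ((U q.1).place q.2.1 ((W q.1 q.2.1).place q.2.2 z))) (hs n _ rfl)
  · have : PlaneIsotopy.refl.eval 1 = id := rfl
    rw [this, image_id]
    change (T.strings ∪ ⋃ i, T.place i '' (U i).strings) ∪ ⋃ k : Fin (∑ i, e i),
        (((U (finSigmaFinEquiv.symm k).1).place (finSigmaFinEquiv.symm k).2).trans
          (T.place (finSigmaFinEquiv.symm k).1)) ''
            (W (finSigmaFinEquiv.symm k).1 (finSigmaFinEquiv.symm k).2).strings =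
      T.strings ∪ ⋃ i, T.place i '' ((U i).strings ∪ ⋃ j, (U i).place j '' (W i j).strings)
    rw [finSigmaFinEquiv.symm.surjective.iUnion_comp (fun p : (i : Fin d) × Fin (e i) =>
      (((U p.1).place p.2).trans (T.place p.1)) '' (W p.1 p.2).strings), iUnion_sigma]
    simp only [image_union, image_iUnion, iUnion_union_distrib, union_assoc, image_image]
    rfl

end Diagram

/-- The multicategory of planar diagrams with the given family of pinned bodies as objects:
morphisms are diagrams up to planar isotopy, and composition is plugging. -/
noncomputable def diagrams {O : Type} (B : O → PinnedBody) : Multicategory where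
  Obj := O
  Hom X Y := Quotient (Diagram.setoid (fun i => B (X i)) (B Y))
  id X := Quotient.mk _ (Diagram.ident (B X))
  comp T U := Diagram.plugClass T U
  id_comp T := Diagram.ident_plugClass T
  comp_id T := Diagram.plugClass_ident T
  assoc T U W := Diagram.plugClass_assoc T U W

/-! ### Disks and boxes -/

/-- The `n`-disk: the unit disk with pins at the `n`-th roots of unity, numbered
anticlockwise. -/
noncomputable def disk (n : ℕ) : PinnedBody where
  gauge z := ‖z‖
  continuous_gauge := continuous_norm
  gauge_smul t z ht := by rw [norm_smul, Real.norm_of_nonneg ht]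
  gauge_pos z hz := norm_pos_iff.2 hz
  Pin := Fin n
  finite_pin := inferInstance
  pin k := Complex.exp (2 * Real.pi * Complex.I * (k / n))
  pin_injective := by
    intro k l h
    have hn : n ≠ 0 := by
      rintro rfl
      exact k.elim0
    have key : ∀ k : Fin n, Complex.exp (2 * Real.pi * Complex.I * (k / n)) =
        Complex.exp (2 * Real.pi * Complex.I / n) ^ (k : ℕ) := by
      intro k
      rw [← Complex.exp_nat_mul]
      congr 1
      ring
    simp only [key] at h
    exact Fin.ext ((Complex.isPrimitiveRoot_exp n hn).pow_inj k.2 l.2 h)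
  gauge_pin k := by
    have : (2 * Real.pi * Complex.I * (k / n) : ℂ) = ((2 * Real.pi * (k / n) : ℝ) : ℂ) * Complex.I := by
      push_cast
      ring
    rw [this, Complex.norm_exp_ofReal_mul_I]

/-- The `i`-th of `m` equidistant interior points of `[-1, 1]`, from left to right. -/
noncomputable def edgePoint (m : ℕ) (i : Fin m) : ℝ := -1 + 2 * (i + 1) / (m + 1)

theorem edgePoint_injective (m : ℕ) : Function.Injective (edgePoint m) := by
  intro i j h
  have hm : (m + 1 : ℝ) ≠ 0 := by positivity
  have h1 : (2 * ((i : ℕ) + 1) / (m + 1) : ℝ) = 2 * ((j : ℕ) + 1) / (m + 1) := add_left_cancel h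
  rw [div_left_inj' hm] at h1
  exact Fin.ext (by exact_mod_cast (by linarith : ((i : ℕ) : ℝ) = (j : ℕ)))

theorem abs_edgePoint_le (m : ℕ) (i : Fin m) : |edgePoint m i| ≤ 1 := by
  have hm : (0 : ℝ) < m + 1 := by positivity
  have hi : ((i : ℕ) : ℝ) + 1 ≤ m := by exact_mod_cast i.2
  have h1 : 2 * (((i : ℕ) : ℝ) + 1) / (m + 1) ≤ 2 := by
    rw [div_le_iff₀ hm]
    linarith
  have h2 : 0 ≤ 2 * (((i : ℕ) : ℝ) + 1) / (m + 1) := by positivity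
  rw [edgePoint, abs_le]
  constructor <;> linarith

/-- The `(m, n)`-box: the square `[-1, 1] × [-1, 1]` with `m` pins on the lower and `n` pins on the
upper edge, both numbered from left to right. -/
noncomputable def box (p : ℕ × ℕ) : PinnedBody where
  gauge z := max |z.re| |z.im|
  continuous_gauge := by fun_prop
  gauge_smul t z ht := by
    simp only [Complex.real_smul, Complex.re_ofReal_mul, Complex.im_ofReal_mul, abs_mul,
      abs_of_nonneg ht]
    rw [mul_max_of_nonneg _ _ ht]
  gauge_pos z hz := by
    by_contra h
    obtain ⟨h1, h2⟩ := max_le_iff.1 (not_lt.1 h)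
    exact hz (Complex.ext (abs_nonpos_iff.1 h1) (abs_nonpos_iff.1 h2))
  Pin := Fin p.1 ⊕ Fin p.2
  finite_pin := inferInstance
  pin := Sum.elim (fun i => ⟨edgePoint p.1 i, -1⟩) (fun j => ⟨edgePoint p.2 j, 1⟩)
  pin_injective := by
    rintro (i | i) (j | j) h
    · rw [edgePoint_injective _ (congrArg Complex.re h)]
    · have := congrArg Complex.im h
      norm_num at this
    · have := congrArg Complex.im h
      norm_num at this
    · rw [edgePoint_injective _ (congrArg Complex.re h)]
  gauge_pin := by
    rintro (i | j)
    · simpa using abs_edgePoint_le p.1 i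
    · simpa using abs_edgePoint_le p.2 j

/-- The multicategory of planar diagrams of disk type. -/
noncomputable def diskDiagrams : Multicategory := diagrams disk

/-- The multicategory of planar diagrams of box type. -/
noncomputable def boxDiagrams : Multicategory := diagrams box

/-- Planar diagrams of disk type, with disks that have an even number of pins. -/
noncomputable def evenDiskDiagrams : Multicategory := diskDiagrams.full fun n : ℕ => Even n

/-- Planar diagrams of box type, with boxes that have an even total number of pins. -/
noncomputable def evenBoxDiagrams : Multicategory :=
  boxDiagrams.full fun p : ℕ × ℕ => Even (p.1 + p.2)

/-- Diagonal diagrams: planar diagrams of box type, with boxes of type `(n, n)`. -/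
noncomputable def diagonalDiagrams : Multicategory :=
  evenBoxDiagrams.full fun p : {p : ℕ × ℕ // Even (p.1 + p.2)} => p.1.1 = p.1.2

end PlanarDiagrams

open PlanarDiagrams CategoryTheory

universe u w

namespace PlanarDiagrams

universe v u' v' u₁ v₁

theorem finSigma_symm_one_left {d : ℕ} (l : Fin (∑ _ : Fin 1, d)) :
    (finSigmaFinEquiv.symm l).2 = Fin.cast (by simp) l := by
  obtain ⟨⟨i, j⟩, rfl⟩ := finSigmaFinEquiv.surjective l
  rw [Equiv.symm_apply_apply]
  exact Fin.ext (finSigmaFinEquiv_one _).symm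

theorem finSigma_symm_one_right {d : ℕ} (l : Fin (∑ _ : Fin d, 1)) :
    (finSigmaFinEquiv.symm l).1 = Fin.cast (by simp) l := by
  obtain ⟨⟨i, j⟩, rfl⟩ := finSigmaFinEquiv.surjective l
  rw [Equiv.symm_apply_apply]
  obtain rfl : j = 0 := Subsingleton.elim _ _
  exact Fin.ext (finSigma_one d i).symm

/-! ### Unary morphisms and transport along isomorphisms of objects -/

namespace Multicategory

section Unary

variable {M : Multicategory.{u, v}}

theorem hom_congr {d d' : ℕ} {X : Fin d → M.Obj} {X' : Fin d' → M.Obj} (hd : d = d')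
    (hX : ∀ i, X i = X' (Fin.cast hd i)) (Y : M.Obj) : M.Hom X Y = M.Hom X' Y := by
  subst hd
  obtain rfl : X = X' := funext hX
  rfl

/-- The congruence rule behind all manipulations of `M.comp`. Input sequences agree only after
`Fin.cast`, so each piece of data gets its own hypothesis, and they are substituted one after
another. -/
theorem comp_heq {d d' : ℕ} (hd : d = d') {X : Fin d → M.Obj} {X' : Fin d' → M.Obj}
    (hX : ∀ i, X i = X' (Fin.cast hd i)) {Y : M.Obj} {e : Fin d → ℕ} {e' : Fin d' → ℕ}
    (he : ∀ i, e i = e' (Fin.cast hd i))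
    {Z : (i : Fin d) → Fin (e i) → M.Obj} {Z' : (i : Fin d') → Fin (e' i) → M.Obj}
    (hZ : ∀ i j, Z i j = Z' (Fin.cast hd i) (Fin.cast (he i) j))
    {T : M.Hom X Y} {T' : M.Hom X' Y} (hT : HEq T T')
    {U : (i : Fin d) → M.Hom (Z i) (X i)} {U' : (i : Fin d') → M.Hom (Z' i) (X' i)}
    (hU : ∀ i, HEq (U i) (U' (Fin.cast hd i))) : HEq (M.comp T U) (M.comp T' U') := by
  subst hd
  obtain rfl : X = X' := funext hX
  obtain rfl : e = e' := funext he
  obtain rfl : Z = Z' := funext fun i => funext (hZ i)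
  obtain rfl := eq_of_heq hT
  obtain rfl : U = U' := funext fun i => eq_of_heq (hU i)
  rfl

/-- Composition with a unary morphism at the output. -/
def post {d : ℕ} {X : Fin d → M.Obj} {Y Y' : M.Obj} (σ : M.Hom (fun _ : Fin 1 => Y) Y')
    (T : M.Hom X Y) : M.Hom X Y' :=
  -- The cast identifies the concatenation of a single block with `X` itself, so that the laws for
  -- `post` and `pre` become plain equations.
  cast (hom_congr (by simp) (fun l => congrArg X (finSigma_symm_one_left l)) Y')
    (M.comp σ fun _ => T)

/-- Composition with unary morphisms at the inputs. -/
def pre {d : ℕ} {X X' : Fin d → M.Obj} {Y : M.Obj} (T : M.Hom X Y)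
    (σ : (i : Fin d) → M.Hom (fun _ : Fin 1 => X' i) (X i)) : M.Hom X' Y :=
  cast (hom_congr (by simp) (fun l => congrArg X' (finSigma_symm_one_right l)) Y) (M.comp T σ)

theorem post_heq {d : ℕ} {X : Fin d → M.Obj} {Y Y' : M.Obj} (σ : M.Hom (fun _ : Fin 1 => Y) Y')
    (T : M.Hom X Y) : HEq (post σ T) (M.comp σ fun _ => T) :=
  cast_heq _ _

theorem pre_heq {d : ℕ} {X X' : Fin d → M.Obj} {Y : M.Obj} (T : M.Hom X Y)
    (σ : (i : Fin d) → M.Hom (fun _ : Fin 1 => X' i) (X i)) : HEq (pre T σ) (M.comp T σ) :=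
  cast_heq _ _

theorem id_post {d : ℕ} {X : Fin d → M.Obj} {Y : M.Obj} (T : M.Hom X Y) : post (M.id Y) T = T :=
  eq_of_heq ((post_heq _ _).trans (M.id_comp T))

theorem pre_id {d : ℕ} {X : Fin d → M.Obj} {Y : M.Obj} (T : M.Hom X Y) :
    pre T (fun i => M.id (X i)) = T :=
  eq_of_heq ((pre_heq _ _).trans (M.comp_id T))

theorem post_comp {d : ℕ} {X : Fin d → M.Obj} {Y Y' : M.Obj} {e : Fin d → ℕ}
    {Z : (i : Fin d) → Fin (e i) → M.Obj} (σ : M.Hom (fun _ : Fin 1 => Y) Y') (T : M.Hom X Y)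
    (U : (i : Fin d) → M.Hom (Z i) (X i)) : post σ (M.comp T U) = M.comp (post σ T) U := by
  refine eq_of_heq ((post_heq _ _).trans ((M.assoc σ (fun _ => T) (fun _ => U)).symm.trans ?_))
  refine comp_heq (by simp) (fun l => congrArg X (finSigma_symm_one_left l))
    (fun l => congrArg e (finSigma_symm_one_left l)) (fun l j => ?_) (post_heq _ _).symm
    (fun l => ?_)
  · exact congr_heq (congr_arg_heq Z (finSigma_symm_one_left l))
      (by rw [Fin.heq_ext_iff (congrArg e (finSigma_symm_one_left l))]; rfl)
  · exact congr_arg_heq U (finSigma_symm_one_left l)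

/-- By associativity a layer of unary morphisms between `T` and the `U i` can be absorbed on either
side. This is what brings an isomorphism next to its inverse in `ObjIso.conj_comp`. -/
theorem comp_pre {d : ℕ} {X X' : Fin d → M.Obj} {Y : M.Obj} {e : Fin d → ℕ}
    {Z : (i : Fin d) → Fin (e i) → M.Obj} (T : M.Hom X Y)
    (σ : (i : Fin d) → M.Hom (fun _ : Fin 1 => X' i) (X i))
    (U : (i : Fin d) → M.Hom (Z i) (X' i)) :
    M.comp (pre T σ) U = M.comp T (fun i => post (σ i) (U i)) := by
  have h1 : HEq (M.comp (pre T σ) U) (M.comp T fun i => M.comp (σ i) fun _ => U i) := by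
    refine HEq.trans (HEq.symm ?_) (M.assoc T σ (fun i _ => U i))
    refine comp_heq (by simp) (fun l => congrArg X' (finSigma_symm_one_right l))
      (fun l => congrArg e (finSigma_symm_one_right l)) (fun l j => ?_) (pre_heq _ _).symm
      (fun l => congr_arg_heq U (finSigma_symm_one_right l))
    exact congr_heq (congr_arg_heq Z (finSigma_symm_one_right l))
      (by rw [Fin.heq_ext_iff (congrArg e (finSigma_symm_one_right l))]; rfl)
  refine eq_of_heq (h1.trans ?_)
  exact comp_heq rfl (fun _ => rfl) (fun i => by simp)
    (fun i j => congrArg (Z i) (finSigma_symm_one_left j)) HEq.rfl fun i => (post_heq _ _).symm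

theorem pre_comp {d : ℕ} {X : Fin d → M.Obj} {Y : M.Obj} {e : Fin d → ℕ}
    {Z Z' : (i : Fin d) → Fin (e i) → M.Obj} (T : M.Hom X Y)
    (U : (i : Fin d) → M.Hom (Z i) (X i))
    (σ : (i : Fin d) → (j : Fin (e i)) → M.Hom (fun _ : Fin 1 => Z' i j) (Z i j)) :
    pre (X' := concat Z') (M.comp T U)
        (fun k => σ (finSigmaFinEquiv.symm k).1 (finSigmaFinEquiv.symm k).2) =
      M.comp T (fun i => pre (U i) (σ i)) := by
  refine eq_of_heq ((pre_heq _ _).trans ((M.assoc T U σ).trans ?_))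
  exact comp_heq rfl (fun _ => rfl) (fun i => by simp)
    (fun i j => congrArg (Z' i) (finSigma_symm_one_right j)) HEq.rfl fun i => (pre_heq _ _).symm

theorem post_pre {d : ℕ} {X X' : Fin d → M.Obj} {Y Y' : M.Obj}
    (σ : M.Hom (fun _ : Fin 1 => Y) Y') (T : M.Hom X Y)
    (τ : (i : Fin d) → M.Hom (fun _ : Fin 1 => X' i) (X i)) :
    post σ (pre T τ) = pre (post σ T) τ := by
  -- `pre T τ` and `M.comp T τ` have different types, so even this replacement under `post σ` is
  -- heterogeneous.
  have h : HEq (post σ (pre T τ)) (post σ (M.comp T τ)) := by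
    refine (post_heq _ _).trans (HEq.trans ?_ (post_heq _ _).symm)
    exact comp_heq rfl (fun _ => rfl) (fun i => by simp)
      (fun i j => (congrArg X' (by rw [finSigma_symm_one_right]; rfl))) HEq.rfl
      fun i => pre_heq _ _
  refine eq_of_heq (h.trans ?_)
  rw [post_comp]
  exact (pre_heq _ _).symm

theorem post_post {d : ℕ} {X : Fin d → M.Obj} {Y Y' Y'' : M.Obj}
    (σ : M.Hom (fun _ : Fin 1 => Y') Y'') (τ : M.Hom (fun _ : Fin 1 => Y) Y') (T : M.Hom X Y) :
    post σ (post τ T) = post (post σ τ) T := by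
  have h : HEq (post σ (post τ T)) (post σ (M.comp τ fun _ => T)) := by
    refine (post_heq _ _).trans (HEq.trans ?_ (post_heq _ _).symm)
    exact comp_heq rfl (fun _ => rfl) (fun i => by simp)
      (fun i j => (congrArg X (by rw [finSigma_symm_one_left]; rfl))) HEq.rfl
      fun i => post_heq _ _
  refine eq_of_heq (h.trans ?_)
  rw [post_comp]
  exact (post_heq _ _).symm

theorem pre_pre {d : ℕ} {X X' X'' : Fin d → M.Obj} {Y : M.Obj} (T : M.Hom X Y)
    (σ : (i : Fin d) → M.Hom (fun _ : Fin 1 => X' i) (X i))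
    (τ : (i : Fin d) → M.Hom (fun _ : Fin 1 => X'' i) (X' i)) :
    pre (pre T σ) τ = pre T (fun i => post (σ i) (τ i)) := by
  refine eq_of_heq ((pre_heq _ _).trans (HEq.trans ?_ (pre_heq _ _).symm))
  rw [comp_pre]

/-- Both are casts of the same composite. -/
theorem pre_eq_post {X Y Z : M.Obj} (σ : M.Hom (fun _ : Fin 1 => Y) Z)
    (τ : M.Hom (fun _ : Fin 1 => X) Y) : pre σ (fun _ => τ) = post σ τ :=
  eq_of_heq ((pre_heq _ _).trans (post_heq _ _).symm)

/-- Two objects are isomorphic through unary morphisms. -/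
structure ObjIso (M : Multicategory.{u, v}) (X Y : M.Obj) where
  hom : M.Hom (fun _ : Fin 1 => X) Y
  inv : M.Hom (fun _ : Fin 1 => Y) X
  hom_inv : post inv hom = M.id X
  inv_hom : post hom inv = M.id Y

namespace ObjIso

/-- The inverse isomorphism. -/
def symm {X Y : M.Obj} (σ : ObjIso M X Y) : ObjIso M Y X :=
  ⟨σ.inv, σ.hom, σ.inv_hom, σ.hom_inv⟩

/-- The composite isomorphism. -/
def trans {X Y Z : M.Obj} (σ : ObjIso M X Y) (τ : ObjIso M Y Z) : ObjIso M X Z where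
  hom := post τ.hom σ.hom
  inv := post σ.inv τ.inv
  hom_inv := by rw [← post_post, post_post τ.inv, τ.hom_inv, id_post, σ.hom_inv]
  inv_hom := by rw [← post_post, post_post σ.hom, σ.inv_hom, id_post, τ.inv_hom]

/-- Transport of a morphism along isomorphisms of its inputs and of its output. -/
def conj {d : ℕ} {X X' : Fin d → M.Obj} {Y Y' : M.Obj} (σ : (i : Fin d) → ObjIso M (X i) (X' i))
    (τ : ObjIso M Y Y') (T : M.Hom X Y) : M.Hom X' Y' :=
  post τ.hom (pre T fun i => (σ i).inv)

theorem conj_id {X Y : M.Obj} (σ : ObjIso M X Y) : conj (fun _ => σ) σ (M.id X) = M.id Y := by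
  rw [conj, pre_eq_post, id_post, σ.inv_hom]

/-- At each intermediate object the inverse of `σ i`, inserted at an input of `T`, meets `σ i`,
inserted at the output of `U i`, and the two cancel. -/
theorem conj_comp {d : ℕ} {X X' : Fin d → M.Obj} {Y Y' : M.Obj} {e : Fin d → ℕ}
    {Z Z' : (i : Fin d) → Fin (e i) → M.Obj} (σ : (i : Fin d) → ObjIso M (X i) (X' i))
    (τ : ObjIso M Y Y') (ρ : (i : Fin d) → (j : Fin (e i)) → ObjIso M (Z i j) (Z' i j))
    (T : M.Hom X Y) (U : (i : Fin d) → M.Hom (Z i) (X i)) :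
    conj (X' := concat Z')
        (fun k => ρ (finSigmaFinEquiv.symm k).1 (finSigmaFinEquiv.symm k).2) τ (M.comp T U) =
      M.comp (conj σ τ T) (fun i => conj (ρ i) (σ i) (U i)) := by
  simp only [conj]
  rw [pre_comp (T := T) (U := U) (σ := fun i j => (ρ i j).inv), ← post_comp, comp_pre]
  simp only [post_post, (σ _).hom_inv, id_post]

/-- The naturality square for the isomorphisms: the inverses that `conj` puts at the inputs cancel
against `(σ i).hom`. -/
theorem conj_post {d : ℕ} {X X' : Fin d → M.Obj} {Y Y' : M.Obj}
    (σ : (i : Fin d) → ObjIso M (X i) (X' i)) (τ : ObjIso M Y Y') (T : M.Hom X Y) :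
    HEq (M.comp τ.hom fun _ => T) (M.comp (conj σ τ T) fun i => (σ i).hom) := by
  refine (post_heq _ _).symm.trans (HEq.trans (heq_of_eq ?_) (pre_heq _ _))
  rw [conj, ← post_pre, pre_pre]
  simp only [(σ _).hom_inv, pre_id]

theorem conj_conj {d : ℕ} {X X' X'' : Fin d → M.Obj} {Y Y' Y'' : M.Obj}
    (σ : (i : Fin d) → ObjIso M (X i) (X' i)) (τ : ObjIso M Y Y')
    (σ' : (i : Fin d) → ObjIso M (X' i) (X'' i)) (τ' : ObjIso M Y' Y'') (T : M.Hom X Y) :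
    conj σ' τ' (conj σ τ T) = conj (fun i => (σ i).trans (σ' i)) (τ.trans τ') T := by
  simp only [conj, trans]
  rw [← post_pre, post_post, pre_pre]

theorem conj_symm_conj {d : ℕ} {X X' : Fin d → M.Obj} {Y Y' : M.Obj}
    (σ : (i : Fin d) → ObjIso M (X i) (X' i)) (τ : ObjIso M Y Y') (T : M.Hom X Y) :
    conj (fun i => (σ i).symm) τ.symm (conj σ τ T) = T := by
  rw [conj_conj]
  simp only [conj, trans, symm, (σ _).hom_inv, τ.hom_inv, pre_id, id_post]

end ObjIso

/-- The multicategory with the morphisms of `M` between the images of the objects under `f`. -/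
def pullback (M : Multicategory.{u, v}) {O : Type u'} (f : O → M.Obj) : Multicategory.{u', v} where
  Obj := O
  Hom X Y := M.Hom (fun i => f (X i)) (f Y)
  id X := M.id (f X)
  comp T U := M.comp T U
  id_comp T := M.id_comp T
  comp_id T := M.comp_id T
  assoc T U W := M.assoc T U W

/-! ### Equivalence of pullbacks along maps of objects -/

section Pullback

variable {O : Type u'} {O' : Type u₁} {g : O' → M.Obj} {f : O → M.Obj}

/-- A map of objects that is covered by isomorphisms in `M` defines a functor. -/
def pullbackFunctor (s : O → O') (σ : (a : O) → ObjIso M (f a) (g (s a))) :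
    MFunctor (M.pullback f) (M.pullback g) where
  obj := s
  map {_ X Y} T := ObjIso.conj (M := M) (fun i => σ (X i)) (σ Y) T
  map_id X := ObjIso.conj_id (σ X)
  map_comp {_ X Y _ Z} T U :=
    ObjIso.conj_comp (fun i => σ (X i)) (σ Y) (fun i j => σ (Z i j)) T U

/-- Conjugation by `σ` is naturally equivalent to the identity with the components of `σ` and their
inverses. The functor enters through the equation `hF` so that a composite of two conjugations,
which is a conjugation only up to a proof, can be used. -/
theorem pullbackFunctor_iso {s : O → O} (σ : (a : O) → ObjIso M (f a) (f (s a)))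
    (F : MFunctor (M.pullback f) (M.pullback f)) (hF : F = pullbackFunctor s σ) :
    Nonempty (MNatIso F (MFunctor.id _)) := by
  subst hF
  refine ⟨⟨⟨fun X => (σ X).inv, ?_⟩, ⟨fun X => (σ X).hom, ?_⟩, fun X => ?_, fun X => ?_⟩⟩
  · intro d X Y T
    -- The square for the inverse isomorphisms is taken at the transported morphism; transporting
    -- back recovers `T`.
    have h := ObjIso.conj_post (fun i => (σ (X i)).symm) (σ Y).symm
      (ObjIso.conj (fun i => σ (X i)) (σ Y) T)
    exact h.trans (heq_of_eq (congrArg (fun S => M.comp S fun i => (σ (X i)).inv)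
      (ObjIso.conj_symm_conj (fun i => σ (X i)) (σ Y) T)))
  · intro d X Y T
    exact ObjIso.conj_post (fun i => σ (X i)) (σ Y) T
  · exact (post_heq (σ X).hom (σ X).inv).symm.trans (heq_of_eq (σ X).inv_hom)
  · exact (post_heq (σ X).inv (σ X).hom).symm.trans (heq_of_eq (σ X).hom_inv)

/-- Each composite of the two functors is conjugation by the composite isomorphisms, so
`pullbackFunctor_iso` applies. The families `σ` and `τ` need not be related to each other. -/
theorem pullback_equivalent (s : O → O') (σ : (a : O) → ObjIso M (f a) (g (s a)))
    (t : O' → O) (τ : (b : O') → ObjIso M (g b) (f (t b))) :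
    (M.pullback f).Equivalent (M.pullback g) := by
  refine ⟨pullbackFunctor s σ, pullbackFunctor t τ, ?_, ?_⟩
  · refine pullbackFunctor_iso (s := fun b => s (t b)) (fun b => (τ b).trans (σ (t b))) _ ?_
    simp only [MFunctor.comp, pullbackFunctor]
    congr 1
    funext d X Y T
    exact ObjIso.conj_conj _ _ _ _ _
  · refine pullbackFunctor_iso (s := fun a => t (s a)) (fun a => (σ a).trans (τ (s a))) _ ?_
    simp only [MFunctor.comp, pullbackFunctor]
    congr 1
    funext d X Y T
    exact ObjIso.conj_conj _ _ _ _ _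

end Pullback

end Unary

end Multicategory

/-! ### Functors and natural transformations in terms of unary composition -/

theorem MFunctor.map_heq {M : Multicategory.{u, v}} {N : Multicategory.{u', v'}} (F : MFunctor M N)
    {d d' : ℕ} {X : Fin d → M.Obj} {X' : Fin d' → M.Obj} {Y : M.Obj} (hd : d = d')
    (hX : ∀ i, X i = X' (Fin.cast hd i)) {T : M.Hom X Y} {T' : M.Hom X' Y} (hT : HEq T T') :
    HEq (F.map T) (F.map T') := by
  subst hd
  obtain rfl : X = X' := funext hX
  obtain rfl := eq_of_heq hT
  rfl

open Multicategory

theorem MFunctor.map_post {M : Multicategory.{u, v}} {N : Multicategory.{u', v'}}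
    (F : MFunctor M N) {d : ℕ} {X : Fin d → M.Obj} {Y Y' : M.Obj}
    (σ : M.Hom (fun _ : Fin 1 => Y) Y') (T : M.Hom X Y) :
    F.map (post σ T) = post (F.map σ) (F.map T) := by
  refine eq_of_heq (HEq.trans ?_ (post_heq _ _).symm)
  rw [← F.map_comp σ (fun _ => T)]
  refine F.map_heq (X' := concat fun _ => X) (show d = ∑ _ : Fin 1, d by simp) (fun l => ?_)
    (post_heq _ _)
  rw [concat, finSigma_symm_one_left]
  rfl

theorem MFunctor.map_pre {M : Multicategory.{u, v}} {N : Multicategory.{u', v'}}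
    (F : MFunctor M N) {d : ℕ} {X X' : Fin d → M.Obj} {Y : M.Obj} (T : M.Hom X Y)
    (σ : (i : Fin d) → M.Hom (fun _ : Fin 1 => X' i) (X i)) :
    F.map (pre T σ) =
      pre (X' := fun i => F.obj (X' i)) (F.map T) (fun i => F.map (σ i)) := by
  refine eq_of_heq (HEq.trans ?_ (pre_heq _ _).symm)
  rw [← F.map_comp T σ]
  refine F.map_heq (X' := concat fun i _ => X' i) (show d = ∑ _ : Fin d, 1 by simp) (fun l => ?_)
    (pre_heq _ _)
  rw [concat, finSigma_symm_one_right]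
  rfl

/-- Naturality as an honest equation, to which a representation can be applied. -/
theorem MNatTrans.post_eq_pre {M : Multicategory.{u, v}} {N : Multicategory.{u', v'}}
    {F G : MFunctor M N} (α : MNatTrans F G) {d : ℕ} {X : Fin d → M.Obj} {Y : M.Obj}
    (T : M.Hom X Y) : post (α.app Y) (F.map T) = pre (G.map T) (fun i => α.app (X i)) :=
  eq_of_heq ((post_heq _ _).trans ((α.naturality T).trans (pre_heq _ _).symm))

/-! ### Representations of equivalent multicategories -/

section Representations

variable {k : Type u} [Field k]

/-- The linear map of a multilinear map in one variable. -/
def unaryLinear {X Y : ModuleCat.{w} k} (σ : MultilinearMap k (fun _ : Fin 1 => X) Y) :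
    X →ₗ[k] Y :=
  (MultilinearMap.ofSubsingleton k X Y (0 : Fin 1)).symm σ

/-- Together with `MVec_pre` this removes the casts for vector spaces: formal composition with unary
morphisms becomes composition with linear maps, which can be evaluated on vectors. -/
theorem MVec_post {d : ℕ} {X : Fin d → ModuleCat.{w} k} {Y Y' : ModuleCat.{w} k}
    (σ : MultilinearMap k (fun _ : Fin 1 => Y) Y') (T : MultilinearMap k (fun i => X i) Y) :
    post (M := MVec.{u, w} k) (X := X) (Y := Y) (Y' := Y') σ T =
      (unaryLinear σ).compMultilinearMap T := by
  refine eq_of_heq ((post_heq (M := MVec.{u, w} k) (X := X) (Y := Y) (Y' := Y') σ T).trans ?_)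
  refine multilinear_heq k (by simp) (fun l => congrArg X (finSigma_symm_one_left l)) _ _ ?_
  intro x x' h
  refine (multilinearComp_apply (Z := fun _ => X) σ (fun _ => T) x (fun _ j => x' j) ?_).trans rfl
  intro i j
  obtain rfl : i = 0 := Subsingleton.elim _ _
  refine HEq.trans ?_ (h _).symm
  have : (finSigmaFinEquiv ⟨0, j⟩ : Fin (∑ _ : Fin 1, d)) = Fin.cast (by simp) j :=
    Fin.ext (by rw [finSigmaFinEquiv_one]; rfl)
  rw [this]
  rfl

theorem MVec_pre {d : ℕ} {X X' : Fin d → ModuleCat.{w} k} {Y : ModuleCat.{w} k}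
    (T : MultilinearMap k (fun i => X i) Y)
    (σ : (i : Fin d) → MultilinearMap k (fun _ : Fin 1 => X' i) (X i)) :
    pre (M := MVec.{u, w} k) (X := X) (X' := X') (Y := Y) T σ =
      T.compLinearMap (fun i => unaryLinear (σ i)) := by
  refine eq_of_heq ((pre_heq (M := MVec.{u, w} k) (X := X) (X' := X') (Y := Y) T σ).trans ?_)
  refine multilinear_heq k (by simp) (fun l => congrArg X' (finSigma_symm_one_right l)) _ _ ?_
  intro x x' h
  refine (multilinearComp_apply (Z := fun i _ => X' i) T σ x (fun i _ => x' i) ?_).trans rfl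
  intro i j
  obtain rfl : j = 0 := Subsingleton.elim _ _
  have : Fin.cast (by simp) (finSigmaFinEquiv ⟨i, 0⟩ : Fin (∑ _ : Fin d, 1)) = i :=
    Fin.ext (finSigma_one d i)
  refine HEq.trans ?_ (h _).symm
  rw [this]

variable {M : Multicategory.{u', v'}} {N : Multicategory.{u₁, v₁}}

theorem MRep.act_post (V : MRep.{u, u', v', w} k M) {d : ℕ} {X : Fin d → M.Obj} {Y Y' : M.Obj}
    (σ : M.Hom (fun _ : Fin 1 => Y) Y') (T : M.Hom X Y) (x : ∀ i, V.space (X i)) :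
    V.act (post σ T) x = V.act σ (fun _ => V.act T x) :=
  congrArg (fun S : MultilinearMap k (fun i => V.space (X i)) (V.space Y') => S x)
    ((MFunctor.map_post V σ T).trans
      (MVec_post (V.act σ) (V.act T)))

theorem MRep.act_pre (V : MRep.{u, u', v', w} k M) {d : ℕ} {X X' : Fin d → M.Obj} {Y : M.Obj}
    (T : M.Hom X Y) (σ : (i : Fin d) → M.Hom (fun _ : Fin 1 => X' i) (X i))
    (x : ∀ i, V.space (X' i)) :
    V.act (pre T σ) x = V.act T (fun i => V.act (σ i) (fun _ => x i)) :=
  congrArg (fun S : MultilinearMap k (fun i => V.space (X' i)) (V.space Y) => S x)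
    ((MFunctor.map_pre V T σ).trans
      (MVec_pre (X' := fun i => V.space (X' i)) (V.act T) (fun i => V.act (σ i))))

theorem MRep.act_id (V : MRep.{u, u', v', w} k M) (X : M.Obj) (x : V.space X) :
    V.act (M.id X) (fun _ => x) = x :=
  congrArg (fun S : MultilinearMap k (fun _ : Fin 1 => V.space X) (V.space X) => S fun _ => x)
    (V.map_id X)

/-- Restriction of representations along a functor. -/
def MRep.restrict (F : MFunctor M N) : MRep.{u, u₁, v₁, w} k N ⥤ MRep.{u, u', v', w} k M where
  obj V := MFunctor.comp F V
  map φ := { app := fun X => φ.app (F.obj X), comm := fun T x => φ.comm (F.map T) x }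

/-- A natural transformation gives intertwiners of restricted representations. -/
def MRep.restrictHom {F G : MFunctor M N} (α : MNatTrans F G) (V : MRep.{u, u₁, v₁, w} k N) :
    (MRep.restrict F).obj V ⟶ (MRep.restrict G).obj V where
  app X := unaryLinear (V.act (α.app X))
  comm {d X Y} T x := by
    -- The intertwining relation is the image of the naturality equation under `V`, evaluated at
    -- `x`.
    have := congrArg (fun S => V.act S x) (α.post_eq_pre T)
    exact (V.act_post _ _ x).symm.trans (this.trans (V.act_pre _ _ x))

theorem MRep.hom_ext {V W : MRep.{u, u', v', w} k M} {φ ψ : V ⟶ W}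
    (h : ∀ X x, φ.app X x = ψ.app X x) : φ = ψ :=
  Intertwiner.ext (funext fun X => LinearMap.ext (h X))

/-- Naturally equivalent functors have isomorphic restriction functors. -/
def MRep.restrictIso {F G : MFunctor M N} (α : MNatIso F G) :
    (MRep.restrict F : MRep.{u, u₁, v₁, w} k N ⥤ _) ≅ MRep.restrict G :=
  NatIso.ofComponents
    (fun V =>
      { hom := MRep.restrictHom α.hom V
        inv := MRep.restrictHom α.inv V
        hom_inv_id := MRep.hom_ext fun X x => by
          refine (V.act_post (α.inv.app X) (α.hom.app X) (fun _ => x)).symm.trans ?_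
          rw [eq_of_heq ((post_heq _ _).trans (α.hom_inv X))]
          exact V.act_id _ x
        inv_hom_id := MRep.hom_ext fun X x => by
          refine (V.act_post (α.hom.app X) (α.inv.app X) (fun _ => x)).symm.trans ?_
          rw [eq_of_heq ((post_heq _ _).trans (α.inv_hom X))]
          exact V.act_id _ x })
    -- Naturality in the representation is the fact that `φ` commutes with the action of the unary
    -- morphism `α.hom.app X`.
    (fun {V W} φ => MRep.hom_ext fun X x => (φ.comm (α.hom.app X) (fun _ => x)).symm)

/-- Equivalent multicategories have equivalent categories of representations. -/
theorem Multicategory.Equivalent.mRep (h : M.Equivalent N) :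
    Nonempty (MRep.{u, u', v', w} k M ≌ MRep.{u, u₁, v₁, w} k N) := by
  obtain ⟨F, G, ⟨α⟩, ⟨β⟩⟩ := h
  -- Restriction is contravariant, so the functor from representations of `M` to those of `N` comes
  -- from `G`. Restricting along `G` and then along `F` is by definition restricting along `F.comp
  -- G`, so the unit comes from `β`.
  exact ⟨CategoryTheory.Equivalence.mk (MRep.restrict G) (MRep.restrict F)
    (MRep.restrictIso β).symm (MRep.restrictIso α)⟩

end Representations

end PlanarDiagrams

namespace PlanarDiagrams

open Set Filter Multicategory
open scoped Topology unitInterval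

/-! ### Isomorphisms of bodies as invertible diagrams -/

theorem IsotopicToId.symm {φ : ℂ ≃ₜ ℂ} (h : IsotopicToId φ) : IsotopicToId φ.symm := by
  obtain ⟨H, hH⟩ := h
  refine ⟨H.symm, fun z => ?_⟩
  obtain ⟨w, rfl⟩ := φ.surjective z
  rw [φ.symm_apply_apply, ← hH, H.eval_symm_eval]

/-- An orientation-preserving homeomorphism of the plane that respects the gauges and the spokes
of two bodies, and commutes with scaling by `1 / 2`. -/
structure BodyIso (X Y : PinnedBody) where
  toHomeo : ℂ ≃ₜ ℂ
  orientation : IsotopicToId toHomeo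
  gauge_eq : ∀ z, Y.gauge (toHomeo z) = X.gauge z
  map_half : ∀ z, toHomeo (Diagram.half z) = Diagram.half (toHomeo z)
  mem_spokes : ∀ z, toHomeo z ∈ Y.spokes ↔ z ∈ X.spokes

namespace BodyIso

variable {X Y Z : PinnedBody}

/-- The inverse of an isomorphism of bodies. -/
noncomputable def symm (φ : BodyIso X Y) : BodyIso Y X where
  toHomeo := φ.toHomeo.symm
  orientation := φ.orientation.symm
  gauge_eq z := by rw [← φ.gauge_eq, φ.toHomeo.apply_symm_apply]
  map_half z := by
    rw [Homeomorph.symm_apply_eq, φ.map_half, φ.toHomeo.apply_symm_apply]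
  mem_spokes z := by rw [← φ.mem_spokes, φ.toHomeo.apply_symm_apply]

/-- The composite of two isomorphisms of bodies. -/
noncomputable def trans (φ : BodyIso X Y) (ψ : BodyIso Y Z) : BodyIso X Z where
  toHomeo := φ.toHomeo.trans ψ.toHomeo
  orientation := φ.orientation.trans ψ.orientation
  gauge_eq z := (ψ.gauge_eq _).trans (φ.gauge_eq z)
  map_half z := by simp only [Homeomorph.trans_apply, φ.map_half, ψ.map_half]
  mem_spokes z := (ψ.mem_spokes _).trans (φ.mem_spokes z)

/-- The diagram with a half-size copy of `X` inside of `Y`, placed by `φ`, and spokes. -/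
noncomputable def diagram (φ : BodyIso X Y) : Diagram (fun _ : Fin 1 => X) Y where
  place _ := Diagram.half.trans φ.toHomeo
  place_orientation _ := Diagram.half_isotopicToId.trans φ.orientation
  place_interior _ z hz := by
    have hz' : X.gauge z ≤ 1 := hz
    rw [Homeomorph.trans_apply, φ.gauge_eq, Diagram.gauge_half]
    linarith
  place_disjoint i j h := absurd (Subsingleton.elim i j) h
  strings := (Diagram.ident Y).strings
  strings_closed := (Diagram.ident Y).strings_closed
  strings_subset := (Diagram.ident Y).strings_subset
  strings_avoid _ z hz h := by
    have h1 : 1 / 2 ≤ Y.gauge (φ.toHomeo (Diagram.half z)) := h.2.1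
    rw [φ.gauge_eq, Diagram.gauge_half] at h1
    linarith
  strings_manifold z hz h1 h2 := by
    -- Since `φ` preserves gauges and commutes with halving, the inner copy of `X` covers the same
    -- set as the half-size copy of `Y`; the local structure is that of the identity diagram.
    refine (Diagram.ident Y).strings_manifold z hz h1 fun i hi => h2 i ?_
    obtain ⟨x, hx, rfl⟩ := hi
    refine ⟨φ.toHomeo.symm x, ?_, ?_⟩
    · change X.gauge _ ≤ 1
      rw [← φ.gauge_eq, φ.toHomeo.apply_symm_apply]
      exact hx
    · rw [Homeomorph.trans_apply, φ.map_half, φ.toHomeo.apply_symm_apply]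
      rfl
  strings_outer := (Diagram.ident Y).strings_outer
  strings_inner i := by
    obtain ⟨r, hr, h⟩ := (Diagram.ident Y).strings_inner i
    refine ⟨r, hr, fun z h1 h2 => ?_⟩
    rw [Homeomorph.trans_apply, φ.map_half, ← φ.mem_spokes]
    exact h _ (by rwa [φ.gauge_eq]) (by rwa [φ.gauge_eq])

/-- The composite has an inner body of a quarter of the size, so it is compared with the identity
plugged into itself. These two diagrams have the same placement and the same strings, and the
constant isotopy suffices; the rescaling is left to `Diagram.ident_plugClass`. -/
theorem plugClass_diagram (φ : BodyIso X Y) :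
    HEq (Diagram.plugClass (Quotient.mk (Diagram.setoid _ _) φ.symm.diagram)
        (fun _ => Quotient.mk (Diagram.setoid _ _) φ.diagram))
      (Quotient.mk (Diagram.setoid _ _) (Diagram.ident X)) := by
  refine HEq.trans (heq_of_eq ?_)
    (Diagram.ident_plugClass (Quotient.mk (Diagram.setoid _ _) (Diagram.ident X)))
  rw [Diagram.plugClass_mk, Diagram.plugClass_mk]
  refine Quotient.sound ⟨PlaneIsotopy.refl, fun _ _ _ => rfl, fun l z _ => ?_, ?_⟩
  · change φ.toHomeo.symm (Diagram.half (φ.toHomeo (Diagram.half z))) =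
      Diagram.half (Diagram.half z)
    -- Commutation with halving lets `φ` meet its inverse across the intermediate scaling.
    rw [← φ.map_half, φ.toHomeo.symm_apply_apply]
  · have h : PlaneIsotopy.refl.eval 1 = _root_.id := rfl
    rw [h, image_id]
    change (Diagram.ident X).strings ∪
        ⋃ _ : Fin 1, Diagram.half.trans φ.toHomeo.symm '' (Diagram.ident Y).strings =
      (Diagram.ident X).strings ∪ ⋃ _ : Fin 1, Diagram.half '' (Diagram.ident X).strings
    congr 2
    funext _
    have h2 : (Diagram.ident Y).strings = φ.toHomeo '' (Diagram.ident X).strings := by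
      ext w
      obtain ⟨z, rfl⟩ := φ.toHomeo.surjective w
      rw [φ.toHomeo.injective.mem_set_image]
      change (φ.toHomeo z ∈ Y.spokes ∧ _ ≤ Y.gauge (φ.toHomeo z) ∧ Y.gauge (φ.toHomeo z) ≤ _) ↔
        (z ∈ X.spokes ∧ _ ≤ X.gauge z ∧ X.gauge z ≤ _)
      rw [φ.mem_spokes, φ.gauge_eq]
    rw [h2, image_image]
    refine image_congr fun z _ => ?_
    rw [Homeomorph.trans_apply, ← φ.map_half, φ.toHomeo.symm_apply_apply]

/-- Isomorphic bodies are isomorphic objects of the multicategory of diagrams. -/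
noncomputable def objIso {O : Type} {B : O → PinnedBody} {a b : O} (φ : BodyIso (B a) (B b)) :
    ObjIso (diagrams B) a b where
  hom := Quotient.mk (Diagram.setoid _ _) φ.diagram
  inv := Quotient.mk (Diagram.setoid _ _) φ.symm.diagram
  hom_inv := eq_of_heq ((post_heq _ _).trans φ.plugClass_diagram)
  inv_hom := eq_of_heq ((post_heq _ _).trans φ.symm.plugClass_diagram)

end BodyIso

end PlanarDiagrams

namespace PlanarDiagrams

open Set Filter Multicategory
open scoped Topology unitInterval

/-! ### Order isomorphisms that match two periodic sequences -/

/-- Piecewise linear interpolation of a sequence indexed by the integers. -/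
noncomputable def interp (a : ℤ → ℝ) (x : ℝ) : ℝ := a ⌊x⌋ + Int.fract x * (a (⌊x⌋ + 1) - a ⌊x⌋)

theorem interp_intCast (a : ℤ → ℝ) (k : ℤ) : interp a k = a k := by simp [interp]

theorem interp_add_natCast {a : ℤ → ℝ} {n : ℕ} {P : ℝ} (ha : ∀ k, a (k + n) = a k + P) (x : ℝ) :
    interp a (x + n) = interp a x + P := by
  have h : ⌊x⌋ + (n : ℤ) + 1 = ⌊x⌋ + 1 + n := by ring
  rw [interp, interp, Int.floor_add_natCast, Int.fract_add_natCast, h, ha, ha]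
  ring

/-- Between consecutive integers the map is affine with positive slope; if the integer parts differ,
the value at the node `⌊x⌋ + 1` separates the two values. -/
theorem interp_strictMono {a : ℤ → ℝ} (ha : StrictMono a) : StrictMono (interp a) := by
  have hpos : ∀ k : ℤ, 0 < a (k + 1) - a k := fun k => sub_pos.2 (ha (lt_add_one k))
  intro x y hxy
  rcases (Int.floor_mono hxy.le).eq_or_lt with h | h
  · have h1 : Int.fract x < Int.fract y := by
      rw [Int.fract, Int.fract, h]
      linarith
    rw [interp, interp, h]
    have := mul_lt_mul_of_pos_right h1 (hpos ⌊y⌋)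
    linarith
  · have h1 : interp a x < a (⌊x⌋ + 1) := by
      have := mul_lt_mul_of_pos_right (Int.fract_lt_one x) (hpos ⌊x⌋)
      rw [interp]
      linarith
    have h2 : a ⌊y⌋ ≤ interp a y := by
      have := mul_nonneg (Int.fract_nonneg y) (hpos ⌊y⌋).le
      rw [interp]
      linarith
    have h3 : a (⌊x⌋ + 1) ≤ a ⌊y⌋ := ha.monotone h
    linarith

theorem periodic_int {a : ℤ → ℝ} {n : ℕ} {P : ℝ} (ha : ∀ k, a (k + n) = a k + P) (k : ℤ) :
    a (k * n) = a 0 + k * P := by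
  induction k using Int.induction_on with
  | zero => simp
  | succ i ih =>
    rw [add_mul, one_mul, ha, ih]
    push_cast
    ring
  | pred i ih =>
    have h := ha ((-(i : ℤ) - 1) * n)
    have h2 : (-(i : ℤ) - 1) * n + n = -(i : ℤ) * n := by ring
    rw [h2, ih] at h
    push_cast at h ⊢
    linarith

/-- A positive period makes the sequence unbounded on both sides, so every `t` lies between two
consecutive terms, where the affine piece reaches it. -/
theorem interp_surjective {a : ℤ → ℝ} (ha : StrictMono a) {n : ℕ} {P : ℝ} (hP : 0 < P)
    (hper : ∀ k, a (k + n) = a k + P) : Function.Surjective (interp a) := by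
  intro t
  obtain ⟨m, hm1, hm2⟩ : ∃ m : ℤ, a m ≤ t ∧ ∀ k, a k ≤ t → k ≤ m := by
    -- At multiples of `n` the sequence is known from `a 0`, so rounding `(t - a 0) / P` up and down
    -- gives indices with values above and below `t`.
    refine Int.exists_greatest_of_bdd ⟨⌈(t - a 0) / P⌉ * n, fun k hk => ?_⟩
      ⟨⌊(t - a 0) / P⌋ * n, ?_⟩
    · have h1 : t ≤ a (⌈(t - a 0) / P⌉ * n) := by
        rw [periodic_int hper]
        have := (div_le_iff₀ hP).1 (Int.le_ceil ((t - a 0) / P))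
        linarith
      exact ha.le_iff_le.1 (hk.trans h1)
    · rw [periodic_int hper]
      have := (le_div_iff₀ hP).1 (Int.floor_le ((t - a 0) / P))
      linarith
  have hm3 : t < a (m + 1) := by
    by_contra h
    have := hm2 _ (not_lt.1 h)
    omega
  have hpos : 0 < a (m + 1) - a m := by linarith
  set s := (t - a m) / (a (m + 1) - a m) with hs
  have hs0 : 0 ≤ s := div_nonneg (by linarith) hpos.le
  have hs1 : s < 1 := (div_lt_one hpos).2 (by linarith)
  have hfl : ⌊(m : ℝ) + s⌋ = m := by
    rw [Int.floor_intCast_add, Int.floor_eq_zero_iff.2 ⟨hs0, hs1⟩, add_zero]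
  refine ⟨m + s, ?_⟩
  rw [interp, Int.fract, hfl, add_sub_cancel_left, hs, div_mul_cancel₀ _ hpos.ne']
  ring

/-- There is an increasing map of the line, compatible with the period, that carries one periodic
sequence to another. -/
theorem exists_orderIso {a b : ℤ → ℝ} (ha : StrictMono a) (hb : StrictMono b) {n : ℕ} {P : ℝ}
    (hP : 0 < P) (hpa : ∀ k, a (k + n) = a k + P) (hpb : ∀ k, b (k + n) = b k + P) :
    ∃ θ : ℝ ≃o ℝ, (∀ x, θ (x + P) = θ x + P) ∧ ∀ k, θ (a k) = b k := by
  -- Both interpolations parametrize the line by a real index, and raising the index by `n` adds `P`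
  -- in both. Going back through one and forward through the other matches terms of equal index and
  -- commutes with the period.
  let α := StrictMono.orderIsoOfSurjective _ (interp_strictMono ha) (interp_surjective ha hP hpa)
  let β := StrictMono.orderIsoOfSurjective _ (interp_strictMono hb) (interp_surjective hb hP hpb)
  have hα : ∀ x, α x = interp a x := fun _ => rfl
  have hβ : ∀ x, β x = interp b x := fun _ => rfl
  refine ⟨α.symm.trans β, fun x => ?_, fun k => ?_⟩
  · obtain ⟨y, rfl⟩ := α.surjective x
    rw [hα, ← interp_add_natCast hpa, ← hα, ← hα]
    simp only [OrderIso.trans_apply, OrderIso.symm_apply_apply, hβ, interp_add_natCast hpb]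
  · rw [← interp_intCast a, ← hα]
    simp only [OrderIso.trans_apply, OrderIso.symm_apply_apply, hβ, interp_intCast]

/-- The translates of a finite subset of a half-open interval by the multiples of its length form
an increasing periodic sequence. -/
theorem exists_periodic_enum (S : Finset ℝ) {c P : ℝ} (hS : S.Nonempty)
    (h : ∀ x ∈ S, c < x ∧ x ≤ c + P) :
    ∃ a : ℤ → ℝ, StrictMono a ∧ (∀ k, a (k + S.card) = a k + P) ∧
      ∀ x, (∃ k, x = a k) ↔ ∃ y ∈ S, ∃ m : ℤ, x = y + m * P := by
  classical
  set n := S.card with hn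
  have hn0 : 0 < n := S.card_pos.2 hS
  -- The elements of `S` in increasing order; the default value `0` is never reached, since
  -- remainders modulo `n` are less than `n`.
  let s : ℕ → ℝ := fun i => if hi : i < n then S.orderEmbOfFin rfl ⟨i, hi⟩ else 0
  have hs : ∀ i (hi : i < n), s i = S.orderEmbOfFin rfl ⟨i, hi⟩ := fun i hi => dif_pos hi
  have hsS : ∀ i, i < n → s i ∈ S := fun i hi => by
    rw [hs i hi]
    exact S.orderEmbOfFin_mem rfl _
  have hex : ∀ y ∈ S, ∃ i < n, s i = y := by
    intro y hy
    have : y ∈ range (S.orderEmbOfFin rfl) := by rwa [Finset.range_orderEmbOfFin]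
    obtain ⟨i, rfl⟩ := this
    exact ⟨i, i.2, hs i i.2⟩
  let a : ℤ → ℝ := fun k => s (k % n).toNat + (k / n : ℤ) * P
  have hnz : (n : ℤ) ≠ 0 := by exact_mod_cast hn0.ne'
  have ha : ∀ (i : ℕ) (q : ℤ), i < n → a (i + n * q) = s i + q * P := by
    intro i q hi
    have h1 : ((i : ℤ) + n * q) % n = i := by
      rw [Int.add_mul_emod_self_left]
      exact Int.emod_eq_of_lt (by positivity) (by exact_mod_cast hi)
    have h2 : ((i : ℤ) + n * q) / n = q := by
      rw [Int.add_mul_ediv_left _ _ hnz, Int.ediv_eq_zero_of_lt (by positivity)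
        (by exact_mod_cast hi), zero_add]
    simp only [a, h1, h2, Int.toNat_natCast]
  have hrep : ∀ k : ℤ, ∃ (i : ℕ) (q : ℤ), i < n ∧ k = i + n * q := by
    intro k
    have h1 := Int.emod_nonneg k hnz
    have h2 := Int.emod_lt_of_pos k (show (0 : ℤ) < n by exact_mod_cast hn0)
    refine ⟨(k % n).toNat, k / n, by omega, ?_⟩
    rw [Int.toNat_of_nonneg h1, Int.emod_add_mul_ediv]
  refine ⟨a, strictMono_int_of_lt_succ fun k => ?_, fun k => ?_, fun x => ⟨?_, ?_⟩⟩
  · obtain ⟨i, q, hi, rfl⟩ := hrep k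
    rw [ha i q hi]
    rcases Nat.lt_or_ge (i + 1) n with h1 | h1
    · have : (i : ℤ) + n * q + 1 = ((i + 1 : ℕ) : ℤ) + n * q := by
        push_cast
        ring
      rw [this, ha _ _ h1, hs i hi, hs _ h1]
      have : S.orderEmbOfFin rfl ⟨i, hi⟩ < S.orderEmbOfFin rfl ⟨i + 1, h1⟩ :=
        (S.orderEmbOfFin rfl).strictMono (by simp [Fin.lt_def])
      linarith
    · have : (i : ℤ) + n * q + 1 = ((0 : ℕ) : ℤ) + n * (q + 1) := by
        have : i + 1 = n := by omega
        rw [← this]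
        push_cast
        ring
      rw [this, ha _ _ hn0]
      -- Passage to the next period: the largest element is at most `c + P`, and the smallest one
      -- exceeds `c`, so its translate by `P` is larger. Here the interval must be open at one end.
      have h2 := (h _ (hsS i hi)).2
      have h3 := (h _ (hsS 0 hn0)).1
      push_cast
      linarith
  · obtain ⟨i, q, hi, rfl⟩ := hrep k
    have : (i : ℤ) + n * q + n = (i : ℤ) + n * (q + 1) := by ring
    rw [this, ha _ _ hi, ha _ _ hi]
    push_cast
    ring
  · rintro ⟨k, rfl⟩
    obtain ⟨i, q, hi, rfl⟩ := hrep k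
    exact ⟨s i, hsS i hi, q, ha i q hi⟩
  · rintro ⟨y, hy, m, rfl⟩
    obtain ⟨i, hi, rfl⟩ := hex y hy
    exact ⟨i + n * m, (ha i m hi).symm⟩

/-! ### The directions of the spokes -/

namespace PinnedBody

variable (X : PinnedBody)

theorem zero_notMem_spokes : (0 : ℂ) ∉ X.spokes := by
  rintro ⟨p, t, ht, h⟩
  have := congrArg X.gauge h
  rw [X.gauge_zero, X.gauge_smul _ _ ht.le, X.gauge_pin, mul_one] at this
  exact ht.ne this

theorem pin_ne_zero (p : X.Pin) : X.pin p ≠ 0 := by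
  intro h
  have := X.gauge_pin p
  rw [h, X.gauge_zero] at this
  exact zero_ne_one this

/-- Pins of equal argument are positive multiples of each other, and both have gauge `1`. -/
theorem arg_pin_injective : Function.Injective fun p => (X.pin p).arg := by
  intro p q h
  have hp := norm_pos_iff.2 (X.pin_ne_zero p)
  have hq := norm_pos_iff.2 (X.pin_ne_zero q)
  have h1 : X.pin q = (‖X.pin q‖ / ‖X.pin p‖) • X.pin p := by
    conv_lhs => rw [← Complex.norm_mul_exp_arg_mul_I (X.pin q)]
    conv_rhs => rw [← Complex.norm_mul_exp_arg_mul_I (X.pin p)]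
    have h' : (X.pin p).arg = (X.pin q).arg := h
    have : (‖X.pin p‖ : ℂ) ≠ 0 := by exact_mod_cast hp.ne'
    rw [h', Complex.real_smul]
    push_cast
    simp only [Complex.norm_mul, Complex.norm_real, Real.norm_eq_abs, abs_norm,
      Complex.norm_exp_ofReal_mul_I, mul_one]
    field_simp
  have h2 := congrArg X.gauge h1
  rw [X.gauge_smul _ _ (by positivity), X.gauge_pin, X.gauge_pin, mul_one] at h2
  rw [← h2, one_smul] at h1
  exact (X.pin_injective h1).symm

/-- Positive scaling does not change the argument, so a unit vector lies on a spoke exactly when its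
angle is that of a pin up to full turns. -/
theorem exp_mem_spokes (x : ℝ) : Complex.exp (x * Complex.I) ∈ X.spokes ↔
    ∃ p, ∃ m : ℤ, x = (X.pin p).arg + m * (2 * Real.pi) := by
  constructor
  · rintro ⟨p, t, ht, h⟩
    have h1 := congrArg Complex.arg h
    rw [Complex.real_smul, Complex.arg_real_mul _ ht, Complex.arg_exp_mul_I] at h1
    -- The number of full turns removed from `x` to bring it into the range of `arg`.
    refine ⟨p, toIocDiv (mul_pos two_pos Real.pi_pos) (-Real.pi) x, ?_⟩
    rw [← h1, ← zsmul_eq_mul, toIocMod_add_toIocDiv_zsmul]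
  · rintro ⟨p, m, rfl⟩
    have h0 := norm_pos_iff.2 (X.pin_ne_zero p)
    refine ⟨p, ‖X.pin p‖⁻¹, inv_pos.2 h0, ?_⟩
    have h1 : Complex.exp (((X.pin p).arg + m * (2 * Real.pi) : ℝ) * Complex.I) =
        Complex.exp ((X.pin p).arg * Complex.I) := by
      rw [Complex.exp_eq_exp_iff_exists_int]
      refine ⟨m, ?_⟩
      push_cast
      ring
    have h2 : (‖X.pin p‖ : ℂ) ≠ 0 := by exact_mod_cast h0.ne'
    rw [h1, Complex.real_smul, Complex.ofReal_inv, eq_inv_mul_iff_mul_eq₀ h2,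
      Complex.norm_mul_exp_arg_mul_I]

/-- The angles of the spokes form an increasing sequence. -/
theorem exists_angles [Nonempty X.Pin] : ∃ a : ℤ → ℝ, StrictMono a ∧
    (∀ k, a (k + Nat.card X.Pin) = a k + 2 * Real.pi) ∧
    ∀ x : ℝ, Complex.exp (x * Complex.I) ∈ X.spokes ↔ ∃ k, x = a k := by
  classical
  have := X.finite_pin
  have := Fintype.ofFinite X.Pin
  let S : Finset ℝ := Finset.univ.image fun p => (X.pin p).arg
  have hcard : S.card = Nat.card X.Pin := by
    rw [Finset.card_image_of_injective _ X.arg_pin_injective, Finset.card_univ,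
      Nat.card_eq_fintype_card]
  -- The interval is the range of `arg`, open at `-π` and closed at `π`.
  obtain ⟨a, h1, h2, h3⟩ := exists_periodic_enum S (c := -Real.pi) (P := 2 * Real.pi)
    (Finset.univ_nonempty.image _) (by
      intro x hx
      obtain ⟨p, -, rfl⟩ := Finset.mem_image.1 hx
      have := Complex.arg_mem_Ioc (X.pin p)
      exact ⟨this.1, by linarith [this.2]⟩)
  refine ⟨a, h1, hcard ▸ h2, fun x => ?_⟩
  rw [h3, X.exp_mem_spokes]
  simp [S]

/-- Two bodies with the same number of pins have the same directions of spokes, up to an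
orientation-preserving homeomorphism of the circle. -/
theorem exists_matching (X Y : PinnedBody) (h : Nat.card X.Pin = Nat.card Y.Pin) :
    ∃ θ : ℝ ≃o ℝ, (∀ x, θ (x + 2 * Real.pi) = θ x + 2 * Real.pi) ∧
      ∀ x : ℝ, Complex.exp (θ x * Complex.I) ∈ Y.spokes ↔ Complex.exp (x * Complex.I) ∈ X.spokes := by
  have := X.finite_pin
  have := Y.finite_pin
  rcases isEmpty_or_nonempty X.Pin with hX | hX
  · have hY : IsEmpty Y.Pin := by
      rw [Nat.card_of_isEmpty] at h
      exact (Finite.card_eq_zero_iff).1 h.symm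
    exact ⟨OrderIso.refl ℝ, fun _ => rfl, fun x =>
      ⟨fun ⟨p, _⟩ => isEmptyElim p, fun ⟨p, _⟩ => isEmptyElim p⟩⟩
  · have hY : Nonempty Y.Pin := by
      have h0 : 0 < Nat.card X.Pin := Nat.card_pos
      rw [h] at h0
      exact (Nat.card_pos_iff.1 h0).1
    obtain ⟨a, ha, hpa, hxa⟩ := X.exists_angles
    obtain ⟨b, hb, hpb, hxb⟩ := Y.exists_angles
    -- Spokes are matched by their position in the two sequences. The numbering of the pins plays no
    -- role: any matching that keeps the cyclic order gives an isomorphism.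
    obtain ⟨θ, h1, h2⟩ := exists_orderIso ha hb Real.two_pi_pos hpa (h ▸ hpb)
    refine ⟨θ, h1, fun x => ?_⟩
    rw [hxa, hxb]
    simp only [← h2, θ.injective.eq_iff]

end PinnedBody

end PlanarDiagrams

namespace PlanarDiagrams

open Set Filter Multicategory
open scoped Topology unitInterval

/-! ### Construction of isotopies -/

/-- A continuous family of bijections of the plane that starts at the identity and does not shrink
vectors too much is an isotopy. -/
theorem PlaneIsotopy.exists_of_bijective (f : I → ℂ → ℂ)
    (hf : Continuous fun x : I × ℂ => f x.1 x.2) (hbij : ∀ t, Function.Bijective (f t))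
    (h0 : ∀ z, f 0 z = z) {c : ℝ} (hc : 0 < c) (hle : ∀ t z, c * ‖z‖ ≤ ‖f t z‖) :
    ∃ H : PlaneIsotopy, ∀ t z, H.eval t z = f t z := by
  let F : I × ℂ → I × ℂ := fun x => (x.1, f x.1 x.2)
  have hF : Continuous F := continuous_fst.prodMk hf
  have hFbij : Function.Bijective F := by
    constructor
    · rintro ⟨t, z⟩ ⟨s, w⟩ h
      obtain rfl : t = s := congrArg Prod.fst h
      have h' : f t z = f t w := congrArg Prod.snd h
      rw [(hbij t).1 h']
    · rintro ⟨t, w⟩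
      obtain ⟨z, rfl⟩ := (hbij t).2 w
      exact ⟨(t, z), rfl⟩
  -- The lower bound on norms makes preimages of compact sets bounded. So `F` is proper, hence
  -- closed, and a continuous closed bijection has a continuous inverse.
  have hproper : IsProperMap F := by
    refine isProperMap_iff_isCompact_preimage.2 ⟨hF, fun K hK => ?_⟩
    obtain ⟨R, hR⟩ := (hK.image continuous_snd).isBounded.exists_norm_le
    refine (isCompact_univ.prod (isCompact_closedBall (0 : ℂ) (R / c))).of_isClosed_subset
      (hK.isClosed.preimage hF) ?_
    rintro ⟨t, z⟩ hz
    refine ⟨mem_univ _, ?_⟩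
    rw [mem_closedBall_zero_iff, le_div_iff₀ hc, mul_comm]
    exact (hle t z).trans (hR _ ⟨_, hz, rfl⟩)
  exact ⟨⟨(Equiv.ofBijective F hFbij).toHomeomorphOfContinuousClosed hF hproper.isClosedMap,
    fun _ => rfl, fun z => Prod.ext rfl (h0 z)⟩, fun _ _ => rfl⟩

theorem PlaneIsotopy.continuous_eval (H : PlaneIsotopy) (t : I) : Continuous (H.eval t) :=
  continuous_snd.comp (H.toHomeo.continuous.comp (Continuous.prodMk_right t))

/-- The homeomorphism at the end of an isotopy. -/
noncomputable def PlaneIsotopy.final (H : PlaneIsotopy) : ℂ ≃ₜ ℂ where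
  toFun := H.eval 1
  invFun := H.symm.eval 1
  left_inv := H.eval_symm_eval 1
  right_inv := H.eval_eval_symm 1
  continuous_toFun := H.continuous_eval 1
  continuous_invFun := H.symm.continuous_eval 1

theorem PlaneIsotopy.final_isotopicToId (H : PlaneIsotopy) : IsotopicToId H.final :=
  ⟨H, fun _ => rfl⟩

/-- The formulas used below divide by `‖z‖` or involve `arg` and are singular only at the origin.
There a bound independent of time forces the values to zero. -/
theorem continuous_of_norm_le {f : I → ℂ → ℂ}
    (hf : ∀ t z, z ≠ 0 → ContinuousAt (fun x : I × ℂ => f x.1 x.2) (t, z))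
    {g : ℂ → ℝ} (hg : Continuous g) (hg0 : g 0 = 0) (hle : ∀ t z, ‖f t z‖ ≤ g z) :
    Continuous fun x : I × ℂ => f x.1 x.2 := by
  refine continuous_iff_continuousAt.2 ?_
  rintro ⟨t, z⟩
  by_cases hz : z = 0
  · subst hz
    have h0 : f t 0 = 0 := norm_le_zero_iff.1 (hg0 ▸ hle t 0)
    rw [ContinuousAt]
    dsimp only
    rw [h0]
    refine squeeze_zero_norm (fun x => hle x.1 x.2) ?_
    have : Continuous fun x : I × ℂ => g x.2 := hg.comp continuous_snd
    have h := this.tendsto (t, 0)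
    dsimp only at h
    rwa [hg0] at h
  · exact hf t z hz

/-! ### Change of the gauge -/

namespace PinnedBody

variable (X : PinnedBody)

/-- The constant is the minimum of the gauge on the unit circle; homogeneity does the rest. -/
theorem exists_gauge_ge : ∃ c > 0, ∀ z, c * ‖z‖ ≤ X.gauge z := by
  obtain ⟨w, hw, hmin⟩ := (isCompact_sphere (0 : ℂ) 1).exists_isMinOn
    ⟨1, by simp⟩ X.continuous_gauge.continuousOn
  refine ⟨X.gauge w, X.gauge_pos w (by rintro rfl; simp at hw), fun z => ?_⟩
  by_cases h : z = 0
  · simp [h, X.gauge_zero]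
  · have hn : 0 < ‖z‖ := norm_pos_iff.2 h
    have h2 : X.gauge w ≤ X.gauge (‖z‖⁻¹ • z) := hmin (by
      rw [mem_sphere_zero_iff_norm, norm_smul, norm_inv, norm_norm, inv_mul_cancel₀ hn.ne'])
    rwa [X.gauge_smul _ _ (inv_pos.2 hn).le, le_inv_mul_iff₀ hn, mul_comm] at h2

/-- The unit disk with pins in the directions of the pins of `X`. -/
noncomputable def round : PinnedBody where
  gauge z := ‖z‖
  continuous_gauge := continuous_norm
  gauge_smul t z ht := by rw [norm_smul, Real.norm_of_nonneg ht]
  gauge_pos z hz := norm_pos_iff.2 hz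
  Pin := X.Pin
  finite_pin := X.finite_pin
  pin p := ‖X.pin p‖⁻¹ • X.pin p
  pin_injective p q h := by
    have hp := inv_pos.2 (norm_pos_iff.2 (X.pin_ne_zero p))
    have hq := inv_pos.2 (norm_pos_iff.2 (X.pin_ne_zero q))
    have h' : ‖X.pin p‖⁻¹ • X.pin p = ‖X.pin q‖⁻¹ • X.pin q := h
    have h2 := congrArg X.gauge h'
    rw [X.gauge_smul _ _ hp.le, X.gauge_smul _ _ hq.le, X.gauge_pin, X.gauge_pin, mul_one,
      mul_one] at h2
    rw [h2] at h'
    exact X.pin_injective (smul_right_injective ℂ hq.ne' h')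
  gauge_pin p := by
    have hp := norm_pos_iff.2 (X.pin_ne_zero p)
    rw [norm_smul, norm_inv, norm_norm, inv_mul_cancel₀ hp.ne']

theorem mem_round_spokes (z : ℂ) : z ∈ X.round.spokes ↔ z ∈ X.spokes := by
  constructor
  · rintro ⟨p, t, ht, rfl⟩
    have hp := norm_pos_iff.2 (X.pin_ne_zero p)
    exact ⟨p, t * ‖X.pin p‖⁻¹, by positivity, (smul_smul _ _ _)⟩
  · rintro ⟨p, t, ht, rfl⟩
    have hp := norm_pos_iff.2 (X.pin_ne_zero p)
    refine ⟨p, t * ‖X.pin p‖, by positivity, ?_⟩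
    change _ = _ • ‖X.pin p‖⁻¹ • X.pin p
    rw [smul_smul, mul_assoc, mul_inv_cancel₀ hp.ne', mul_one]

/-- The gauge at time `t` of the deformation of the norm into the gauge of `X`. -/
noncomputable def mixedGauge (t : I) (z : ℂ) : ℝ := (1 - (t : ℝ)) * ‖z‖ + t * X.gauge z

theorem mixedGauge_smul (t : I) {s : ℝ} (hs : 0 ≤ s) (z : ℂ) :
    X.mixedGauge t (s • z) = s * X.mixedGauge t z := by
  rw [mixedGauge, mixedGauge, X.gauge_smul _ _ hs, norm_smul, Real.norm_of_nonneg hs]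
  ring

theorem mixedGauge_pos (t : I) {z : ℂ} (hz : z ≠ 0) : 0 < X.mixedGauge t z := by
  have h1 := norm_pos_iff.2 hz
  have h2 := X.gauge_pos z hz
  have h3 := t.2.1
  have h4 := t.2.2
  rcases h3.eq_or_lt with h | h
  · rw [mixedGauge, ← h]
    linarith
  · exact add_pos_of_nonneg_of_pos (mul_nonneg (by linarith) h1.le) (mul_pos h h2)

/-- This rescaling turns the mixed gauge into the norm. At the origin both sides vanish, whatever
the quotient by zero. -/
theorem norm_mixedGauge_smul (t : I) (z : ℂ) :
    ‖(X.mixedGauge t z / ‖z‖) • z‖ = X.mixedGauge t z := by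
  by_cases hz : z = 0
  · simp [hz, mixedGauge, X.gauge_zero]
  · have h1 := norm_pos_iff.2 hz
    rw [norm_smul, Real.norm_of_nonneg (div_nonneg (X.mixedGauge_pos t hz).le h1.le),
      div_mul_cancel₀ _ h1.ne']

/-- The factor is homogeneous of degree zero, hence constant and positive on each ray from the
origin; the inverse multiplies by its reciprocal. -/
theorem bijective_mixedGauge_smul (t : I) :
    Function.Bijective fun z : ℂ => (X.mixedGauge t z / ‖z‖) • z := by
  refine Function.bijective_iff_has_inverse.2
    ⟨fun z => (‖z‖ / X.mixedGauge t z) • z, fun z => ?_, fun z => ?_⟩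
  · by_cases hz : z = 0
    · simp [hz]
    · have h1 := norm_pos_iff.2 hz
      have h2 := X.mixedGauge_pos t hz
      dsimp only
      rw [X.norm_mixedGauge_smul, X.mixedGauge_smul t (by positivity), smul_smul]
      convert one_smul ℝ z using 2
      field_simp
  · by_cases hz : z = 0
    · simp [hz]
    · have h1 := norm_pos_iff.2 hz
      have h2 := X.mixedGauge_pos t hz
      dsimp only
      rw [norm_smul, Real.norm_of_nonneg (by positivity), X.mixedGauge_smul t (by positivity),
        smul_smul]
      convert one_smul ℝ z using 2
      field_simp

theorem continuous_mixedGauge_smul :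
    Continuous fun x : I × ℂ => (X.mixedGauge x.1 x.2 / ‖x.2‖) • x.2 := by
  have hg := X.continuous_gauge
  refine continuous_of_norm_le (f := fun t z => (X.mixedGauge t z / ‖z‖) • z) (fun t z hz => ?_)
    (g := fun z => ‖z‖ + X.gauge z) (by fun_prop) (by simp [X.gauge_zero]) fun t z => ?_
  · unfold mixedGauge
    have : ‖z‖ ≠ 0 := norm_ne_zero_iff.2 hz
    fun_prop (disch := assumption)
  · rw [X.norm_mixedGauge_smul, mixedGauge]
    have h1 := t.2.1
    have h2 := t.2.2
    have := X.gauge_nonneg z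
    have := norm_nonneg z
    nlinarith

theorem mixedGauge_ge {c : ℝ} (hc : ∀ z, c * ‖z‖ ≤ X.gauge z) (t : I) (z : ℂ) :
    min c 1 * ‖z‖ ≤ X.mixedGauge t z := by
  have h1 := t.2.1
  have h2 := t.2.2
  have h4 := norm_nonneg z
  have h5 : min c 1 * ‖z‖ ≤ X.gauge z :=
    (mul_le_mul_of_nonneg_right (min_le_left c 1) h4).trans (hc z)
  have h6 := mul_le_mul_of_nonneg_right (min_le_right c 1) h4
  rw [mixedGauge]
  nlinarith

/-- Multiplication by `X.gauge z / ‖z‖` turns the gauge into the norm, keeps every ray and commutes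
with halving. Deforming the norm linearly into the gauge gives the isotopy from the identity. -/
theorem exists_roundIso : Nonempty (BodyIso X X.round) := by
  obtain ⟨c, hc, hcX⟩ := X.exists_gauge_ge
  have h0 : ∀ z : ℂ, (X.mixedGauge 0 z / ‖z‖) • z = z := fun z => by
    by_cases hz : z = 0
    · simp [hz]
    · simp [mixedGauge, div_self (norm_ne_zero_iff.2 hz)]
  obtain ⟨H, hH⟩ := PlaneIsotopy.exists_of_bijective
    (fun t z => (X.mixedGauge t z / ‖z‖) • z) X.continuous_mixedGauge_smul
    X.bijective_mixedGauge_smul h0 (lt_min hc one_pos)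
    (fun t z => (X.mixedGauge_ge hcX t z).trans_eq (X.norm_mixedGauge_smul t z).symm)
  have hone : ∀ z, X.mixedGauge 1 z = X.gauge z := fun z => by simp [mixedGauge]
  have hval : ∀ z, H.final z = (X.gauge z / ‖z‖) • z := fun z => by
    rw [← hone]
    exact hH 1 z
  refine ⟨⟨H.final, H.final_isotopicToId, fun z => ?_, fun z => ?_, fun z => ?_⟩⟩
  · rw [hval, ← hone]
    exact X.norm_mixedGauge_smul 1 z
  · rw [hval, hval, Diagram.gauge_half, Diagram.half_apply, Diagram.half_apply, norm_smul,
      smul_smul, smul_smul]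
    congr 1
    rw [Real.norm_of_nonneg (by norm_num)]
    ring
  · rw [mem_round_spokes, hval]
    by_cases hz : z = 0
    · simp [hz]
    · exact X.smul_mem_spokes (div_pos (X.gauge_pos z hz) (norm_pos_iff.2 hz)) z

end PinnedBody

/-! ### Rotation of the rays -/

section Rotation

theorem periodic_arg {ψ : ℝ → ℝ} (hψ : Function.Periodic ψ (2 * Real.pi)) {r : ℝ} (hr : 0 < r)
    (x : ℝ) : ψ (Complex.arg (r * Complex.exp (x * Complex.I))) = ψ x := by
  rw [Complex.arg_real_mul _ hr, Complex.arg_exp_mul_I, toIocMod, hψ.sub_zsmul_eq]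

/-- The jump of `arg` on the negative axis is invisible to a periodic `ψ`: it factors through
`Real.Angle`, where the argument is continuous away from the origin. -/
theorem continuousAt_periodic_arg {ψ : ℝ → ℝ} (hψ : Function.Periodic ψ (2 * Real.pi))
    (hc : Continuous ψ) {z : ℂ} (hz : z ≠ 0) : ContinuousAt (fun z => ψ (Complex.arg z)) z := by
  have h1 : Continuous (hψ.lift : Real.Angle → ℝ) := continuous_quot_lift _ hc
  exact h1.continuousAt.comp (Complex.continuousAt_arg_coe_angle hz)

theorem exists_polar (z : ℂ) : ∃ (r x : ℝ), 0 ≤ r ∧ z = r * Complex.exp (x * Complex.I) :=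
  ⟨‖z‖, z.arg, norm_nonneg z, (Complex.norm_mul_exp_arg_mul_I z).symm⟩

theorem norm_polar {r : ℝ} (hr : 0 ≤ r) (x : ℝ) : ‖(r : ℂ) * Complex.exp (x * Complex.I)‖ = r := by
  rw [Complex.norm_mul, Complex.norm_exp_ofReal_mul_I, mul_one, Complex.norm_real,
    Real.norm_of_nonneg hr]

/-- The map that turns the ray of angle `x` by the angle `ψ x`. -/
noncomputable def turn (ψ : ℝ → ℝ) (z : ℂ) : ℂ := z * Complex.exp (ψ z.arg * Complex.I)

theorem norm_turn (ψ : ℝ → ℝ) (z : ℂ) : ‖turn ψ z‖ = ‖z‖ := by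
  rw [turn, Complex.norm_mul, Complex.norm_exp_ofReal_mul_I, mul_one]

theorem turn_polar {ψ : ℝ → ℝ} (hψ : Function.Periodic ψ (2 * Real.pi)) {r : ℝ} (hr : 0 ≤ r)
    (x : ℝ) : turn ψ (r * Complex.exp (x * Complex.I)) =
      r * Complex.exp ((x + ψ x : ℝ) * Complex.I) := by
  rcases hr.eq_or_lt with rfl | hr
  · simp [turn]
  · rw [turn, periodic_arg hψ hr, mul_assoc, ← Complex.exp_add]
    push_cast
    rw [add_mul]

/-- Each circle about the origin is mapped to itself, and there the map lifts to the increasing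
bijection `x + ψ x` of the line, which commutes with full turns. -/
theorem turn_bijective {ψ : ℝ → ℝ} (hψ : Function.Periodic ψ (2 * Real.pi)) (hc : Continuous ψ)
    (hmono : StrictMono fun x => x + ψ x) : Function.Bijective (turn ψ) := by
  constructor
  · intro z w h
    have hn : ‖z‖ = ‖w‖ := by rw [← norm_turn ψ z, h, norm_turn]
    obtain ⟨r, x, hr, rfl⟩ := exists_polar z
    obtain ⟨s, y, hs, rfl⟩ := exists_polar w
    rw [norm_polar hr, norm_polar hs] at hn
    subst hn
    rcases hr.eq_or_lt with rfl | hr0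
    · simp
    · have hr' : (r : ℂ) ≠ 0 := by exact_mod_cast hr0.ne'
      rw [turn_polar hψ hr, turn_polar hψ hr] at h
      obtain ⟨n, hn⟩ := Complex.exp_eq_exp_iff_exists_int.1 (mul_left_cancel₀ hr' h)
      -- The angles of the images differ by `n` full turns; moving these into the argument allows
      -- the injectivity of the lift to be used.
      have h1 : x + ψ x = (y + n * (2 * Real.pi)) + ψ (y + n * (2 * Real.pi)) := by
        rw [hψ.int_mul]
        have h2 : (((x + ψ x : ℝ) : ℂ)) = ((y + ψ y + n * (2 * Real.pi) : ℝ) : ℂ) := by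
          refine mul_right_cancel₀ Complex.I_ne_zero (hn.trans ?_)
          push_cast
          ring
        have h3 := Complex.ofReal_injective h2
        linarith
      have h2 : x = y + n * (2 * Real.pi) := hmono.injective h1
      congr 1
      rw [Complex.exp_eq_exp_iff_exists_int]
      refine ⟨n, ?_⟩
      rw [h2]
      push_cast
      ring
  · intro w
    obtain ⟨r, y, hr, rfl⟩ := exists_polar w
    -- A continuous periodic function is bounded, so the lift stays within bounded distance of the
    -- identity and is surjective by the intermediate value theorem.
    obtain ⟨C, hC⟩ : ∃ C, ∀ x, |ψ x| ≤ C := by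
      obtain ⟨C, hC⟩ := (hψ.compact_of_continuous Real.two_pi_pos.ne' hc).isBounded.exists_norm_le
      exact ⟨C, fun x => hC _ ⟨x, rfl⟩⟩
    have hsurj : Function.Surjective fun x => x + ψ x := by
      refine Continuous.surjective (by fun_prop) ?_ ?_
      · exact tendsto_atTop_add_right_of_le _ (-C) tendsto_id fun x => (abs_le.1 (hC x)).1
      · exact tendsto_atBot_add_right_of_ge _ C tendsto_id fun x => (abs_le.1 (hC x)).2
    obtain ⟨x, rfl⟩ := hsurj y
    exact ⟨r * Complex.exp (x * Complex.I), turn_polar hψ hr x⟩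

theorem continuous_turn {ψ : ℝ → ℝ} (hψ : Function.Periodic ψ (2 * Real.pi)) (hc : Continuous ψ) :
    Continuous fun x : I × ℂ => turn (fun y => (x.1 : ℝ) * ψ y) x.2 := by
  refine continuous_of_norm_le (f := fun t => turn fun x => (t : ℝ) * ψ x) (fun t z hz => ?_)
    continuous_norm norm_zero fun t z => (norm_turn _ z).le
  have h1 : ContinuousAt (fun x : I × ℂ => ψ x.2.arg) (t, z) :=
    ContinuousAt.comp (f := Prod.snd) (g := fun z : ℂ => ψ z.arg)
      (continuousAt_periodic_arg hψ hc hz) continuousAt_snd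
  have h2 : ContinuousAt (fun x : I × ℂ => (((x.1 : ℝ) * ψ x.2.arg : ℝ) : ℂ)) (t, z) :=
    Complex.continuous_ofReal.continuousAt.comp
      ((continuous_subtype_val.comp continuous_fst).continuousAt.mul h1)
  exact continuousAt_snd.mul ((h2.mul continuousAt_const).cexp)

/-- The isotopy turns each ray along the straight path from angle `x` to angle `θ x`. Convex
combinations of the identity and `θ` remain increasing and compatible with full turns, so every
stage is bijective. -/
theorem exists_rotationIso {X Y : PinnedBody} (hX : ∀ z, X.gauge z = ‖z‖)
    (hY : ∀ z, Y.gauge z = ‖z‖) (θ : ℝ ≃o ℝ) (hθ : ∀ x, θ (x + 2 * Real.pi) = θ x + 2 * Real.pi)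
    (h : ∀ x : ℝ, Complex.exp (θ x * Complex.I) ∈ Y.spokes ↔
      Complex.exp (x * Complex.I) ∈ X.spokes) : Nonempty (BodyIso X Y) := by
  have hc : Continuous fun x => θ x - x := θ.continuous.sub continuous_id
  have hper : Function.Periodic (fun x => θ x - x) (2 * Real.pi) := fun x => by
    dsimp only
    rw [hθ]
    ring
  have hmono : ∀ t : I, StrictMono fun x => x + (t : ℝ) * (θ x - x) := fun t x y hxy => by
    have h1 := t.2.1
    have h2 := t.2.2
    have h3 := θ.strictMono hxy
    dsimp only
    rcases h1.eq_or_lt with h | h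
    · rw [← h]
      linarith
    · have h4 := mul_lt_mul_of_pos_left h3 h
      have h5 := mul_le_mul_of_nonneg_left hxy.le (sub_nonneg.2 h2)
      linarith
  obtain ⟨H, hH⟩ := PlaneIsotopy.exists_of_bijective
    (fun t => turn fun x => (t : ℝ) * (θ x - x)) (continuous_turn hper hc)
    (fun t => turn_bijective (fun x => congrArg ((t : ℝ) * ·) (hper x)) (hc.const_mul _) (hmono t))
    (fun z => by simp [turn]) one_pos (fun t z => by rw [norm_turn, one_mul])
  have hval : ∀ z, H.final z = turn (fun x => θ x - x) z := fun z =>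
    (hH 1 z).trans (by simp)
  refine ⟨⟨H.final, H.final_isotopicToId, fun z => ?_, fun z => ?_, fun z => ?_⟩⟩
  · rw [hX, hY, hval, norm_turn]
  · have hhalf : ∀ w, Diagram.half w = ((1 / 2 : ℝ) : ℂ) * w := fun _ => rfl
    -- Halving does not change the argument, so the angle of the turn is the same.
    rw [hval, hval, hhalf, hhalf, turn, turn, Complex.arg_real_mul _ (by norm_num), mul_assoc]
  · rw [hval]
    obtain ⟨r, x, hr, rfl⟩ := exists_polar z
    rw [turn_polar hper hr, add_sub_cancel]
    rcases hr.eq_or_lt with rfl | hr0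
    · simp [PinnedBody.zero_notMem_spokes]
    · exact (Y.smul_mem_spokes hr0 _).trans ((h x).trans (X.smul_mem_spokes hr0 _).symm)

end Rotation

/-- Bodies with the same number of pins are isomorphic. -/
theorem BodyIso.exists_of_card_eq {X Y : PinnedBody} (h : Nat.card X.Pin = Nat.card Y.Pin) :
    Nonempty (BodyIso X Y) := by
  obtain ⟨α⟩ := X.exists_roundIso
  obtain ⟨β⟩ := Y.exists_roundIso
  -- Rounding keeps the type of pins, so `h` applies as it stands.
  obtain ⟨θ, h1, h2⟩ := PinnedBody.exists_matching X.round Y.round h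
  obtain ⟨ρ⟩ := exists_rotationIso (fun _ => rfl) (fun _ => rfl) θ h1 h2
  exact ⟨(α.trans ρ).trans β.symm⟩

/-! ### The multicategory of disks and boxes -/

/-- Disks and boxes. -/
noncomputable def diskOrBox : ℕ ⊕ (ℕ × ℕ) → PinnedBody := Sum.elim disk box

/-- The number of pins of a disk or a box. -/
def pinCount : ℕ ⊕ (ℕ × ℕ) → ℕ := Sum.elim (fun n => n) (fun p => p.1 + p.2)

theorem card_pin_diskOrBox (a : ℕ ⊕ (ℕ × ℕ)) : Nat.card (diskOrBox a).Pin = pinCount a := by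
  rcases a with n | p
  · exact Nat.card_fin n
  · change Nat.card (Fin p.1 ⊕ Fin p.2) = p.1 + p.2
    simp

/-- Disks and boxes with the same number of pins are isomorphic. -/
noncomputable def diskOrBoxIso {a b : ℕ ⊕ (ℕ × ℕ)} (h : pinCount a = pinCount b) :
    ObjIso (diagrams diskOrBox) a b :=
  (Classical.choice (BodyIso.exists_of_card_eq
    (by rw [card_pin_diskOrBox, card_pin_diskOrBox, h]))).objIso

theorem pullback_diskOrBox_equivalent {O O' : Type} {f : O → ℕ ⊕ (ℕ × ℕ)} {g : O' → ℕ ⊕ (ℕ × ℕ)}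
    (s : O → O') (hs : ∀ a, pinCount (g (s a)) = pinCount (f a))
    (t : O' → O) (ht : ∀ b, pinCount (f (t b)) = pinCount (g b)) :
    ((diagrams diskOrBox).pullback f).Equivalent ((diagrams diskOrBox).pullback g) :=
  pullback_equivalent s (fun a => diskOrBoxIso (hs a).symm) t (fun b => diskOrBoxIso (ht b).symm)

/-! ### The equivalences between the five multicategories -/

theorem disk_equivalent_box : diskDiagrams.Equivalent boxDiagrams :=
  -- Both sides are pullbacks of `diagrams diskOrBox` by unfolding. A disk goes to the box with all
  -- pins on the lower edge.
  pullback_diskOrBox_equivalent (f := Sum.inl) (g := Sum.inr) (fun n => (n, 0)) (fun _ => rfl)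
    (fun p => p.1 + p.2) (fun _ => rfl)

theorem evenDisk_equivalent_evenBox : evenDiskDiagrams.Equivalent evenBoxDiagrams :=
  pullback_diskOrBox_equivalent (f := fun n : {n : ℕ // Even n} => Sum.inl n.1)
    (g := fun p : {p : ℕ × ℕ // Even (p.1 + p.2)} => Sum.inr p.1)
    (fun n => ⟨(n.1, 0), n.2⟩) (fun _ => rfl) (fun p => ⟨p.1.1 + p.1.2, p.2⟩) (fun _ => rfl)

theorem half_add_half {n : ℕ} (h : Even n) : n / 2 + n / 2 = n := by
  obtain ⟨m, rfl⟩ := h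
  omega

theorem evenBox_equivalent_diagonal : evenBoxDiagrams.Equivalent diagonalDiagrams :=
  pullback_diskOrBox_equivalent (f := fun p : {p : ℕ × ℕ // Even (p.1 + p.2)} => Sum.inr p.1)
    (g := fun p : {p : {p : ℕ × ℕ // Even (p.1 + p.2)} // p.1.1 = p.1.2} => Sum.inr p.1.1)
    -- The pins are shared equally between the two edges; evenness makes the integer division exact.
    -- In the other direction the inclusion is used.
    (fun p => ⟨⟨((p.1.1 + p.1.2) / 2, (p.1.1 + p.1.2) / 2), ⟨_, rfl⟩⟩, rfl⟩)
    (fun p => half_add_half p.2) (fun p => p.1) (fun _ => rfl)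

theorem evenDisk_equivalent_diagonal : evenDiskDiagrams.Equivalent diagonalDiagrams :=
  pullback_diskOrBox_equivalent (f := fun n : {n : ℕ // Even n} => Sum.inl n.1)
    (g := fun p : {p : {p : ℕ × ℕ // Even (p.1 + p.2)} // p.1.1 = p.1.2} => Sum.inr p.1.1)
    (fun n => ⟨⟨(n.1 / 2, n.1 / 2), ⟨_, rfl⟩⟩, rfl⟩)
    (fun n => half_add_half n.2) (fun p => ⟨p.1.1.1 + p.1.1.2, p.1.2⟩) (fun _ => rfl)

end PlanarDiagrams

theorem mainTheorem6 :
    diskDiagrams.Equivalent boxDiagrams ∧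
    (evenDiskDiagrams.Equivalent evenBoxDiagrams ∧
      evenBoxDiagrams.Equivalent diagonalDiagrams ∧
      evenDiskDiagrams.Equivalent diagonalDiagrams) ∧
    ∀ (k : Type u) [Field k],
      Nonempty (MRep.{u, 0, 0, w} k diskDiagrams ≌ MRep.{u, 0, 0, w} k boxDiagrams) ∧
      Nonempty (MRep.{u, 0, 0, w} k evenDiskDiagrams ≌ MRep.{u, 0, 0, w} k evenBoxDiagrams) ∧
      Nonempty (MRep.{u, 0, 0, w} k evenBoxDiagrams ≌ MRep.{u, 0, 0, w} k diagonalDiagrams) ∧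
      Nonempty (MRep.{u, 0, 0, w} k evenDiskDiagrams ≌ MRep.{u, 0, 0, w} k diagonalDiagrams) :=
  ⟨disk_equivalent_box,
    ⟨evenDisk_equivalent_evenBox, evenBox_equivalent_diagonal, evenDisk_equivalent_diagonal⟩,
    fun _ _ => ⟨disk_equivalent_box.mRep, evenDisk_equivalent_evenBox.mRep,
      evenBox_equivalent_diagonal.mRep, evenDisk_equivalent_diagonal.mRep⟩⟩
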